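/- Let $\mu$ be a compactly supported probability measure on $\mathbb{R}$. Then there exists a family $(\mu_t)_{t\ge 1}$ ($t\in\mathbb{R}$, $t\geq 1$) of compactly supported probability measures on $\mathbb{R}$ such that, for every $t\ge 1$, $$R_{\mu_t}(z)=t\cdot R_\mu(z)\qquad\text{for all } z\in\mathbb{C} \text{ with } |z| \text{ sufficiently small.}$$ In particular, $\mu_1=\mu$ and $\mu_{s+t}=\mu_s\boxplus\mu_t$ for all $s,t\ge 1$. Moreover, for every $n\ge 1$, the $n$-th moment $t\mapsto m_n^{\mu_t}$ and the $n$-th free cumulant $t\mapsto\kappa_n^{\mu_t}$ are continuous functions of $t\in[1,\infty)$. Here, for a compactly supported probability measure $\nu$ on $\mathbb{R}$: the moments are $m_n^\nu=\int x^n\,d\nu(x)$; the free cumulants $\kappa_n^\nu$ are determined by $m_n^\nu=\sum_{\pi\in NC(n)}\prod_{V\in\pi}\kappa^\nu_{\#V}$ for all $n\ge1$, where $NC(n)$ is the set of non-crossing partitions of $\{1,\dots,n\}$; with the Cauchy transform $G_\nu(z)=\int\frac{1}{z-x}\,d\nu(x)$, the $R$-transform $R_\nu$ is the function, analytic near $0$,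 that satisfies $G_\nu\bigl(R_\nu(z)+\frac1z\bigr)=z$ for all sufficiently small $z\ne0$ (in particular it exists). The free convolution $\nu_1\boxplus\nu_2$ is the compactly supported probability measure whose moments are those of $x+y$, where $x,y$ are free self-adjoint random variables in a $*$-probability space with distributions $\nu_1$ and $\nu_2$. -/

import Mathlib

open MeasureTheory Filter Topology
open scoped ComplexOrder

namespace FreeProb

/-! Compactly supported probability measures on the real line. -/

/-- `μ` is a probability measure on `ℝ` with `μ([-M, M]) = 1` for some `M > 0`. -/
def IsCompactlySupportedProb (μ : Measure ℝ) : Prop :=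
  IsProbabilityMeasure μ ∧ ∃ M : ℝ, 0 < M ∧ μ (Set.Icc (-M) M) = 1

/-- The `n`-th moment of `μ`. -/
noncomputable def moment (μ : Measure ℝ) (n : ℕ) : ℝ := ∫ x, x ^ n ∂μ

/-! Non-crossing partitions and free cumulants. -/

/-- A partition of `{0, …, n-1}` is non-crossing if there are no `p₁ < q₁ < p₂ < q₂` with `p₁, p₂`
in one block and `q₁, q₂` in a different block. -/
def NonCrossing {n : ℕ} (π : Finpartition (Finset.univ : Finset (Fin n))) : Prop :=
  ∀ V ∈ π.parts, ∀ W ∈ π.parts, V ≠ W →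
    ¬ ∃ p₁ ∈ V, ∃ q₁ ∈ W, ∃ p₂ ∈ V, ∃ q₂ ∈ W, p₁ < q₁ ∧ q₁ < p₂ ∧ p₂ < q₂

open scoped Classical in
/-- The set `NC(n)` of non-crossing partitions of an `n`-element chain. -/
noncomputable def NC (n : ℕ) : Finset (Finpartition (Finset.univ : Finset (Fin n))) :=
  Finset.univ.filter NonCrossing

open scoped Classical in
/-- The free cumulants `κ n` of a moment sequence `m`: the solution of the moment-cumulant formula
`m n = ∑ π ∈ NC n, ∏ V ∈ π, κ |V|`, solved recursively for the term of the one-block partition `⊤`.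
All blocks of a partition other than `⊤` have fewer than `n` elements, so the `else` branch is
never used; see `moment_cumulant_formula`. -/
noncomputable def freeCumulant (m : ℕ → ℝ) (n : ℕ) : ℝ :=
  m n - ∑ π ∈ (NC n).erase ⊤, ∏ V ∈ π.parts, if _h : V.card < n then freeCumulant m V.card else 0
termination_by n

theorem card_lt_of_ne_top {n : ℕ} {π : Finpartition (Finset.univ : Finset (Fin n))}
    (hπ : π.parts ≠ {Finset.univ}) {V : Finset (Fin n)} (hV : V ∈ π.parts) : V.card < n := by
  have hle : V.card ≤ n := by simpa using Finset.card_le_univ V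
  rcases hle.lt_or_eq with h | h
  · exact h
  · exfalso
    have hVu : V = Finset.univ := by
      apply Finset.eq_univ_of_card; simpa using h
    apply hπ
    apply Finset.eq_singleton_iff_unique_mem.2
    refine ⟨hVu ▸ hV, fun W hW => ?_⟩
    by_contra hne
    have hd := π.disjoint hW (hVu ▸ hV) hne
    have : W = ∅ := Finset.disjoint_self_iff_empty W |>.1
      (Finset.disjoint_of_subset_right (Finset.subset_univ W) hd)
    exact π.ne_bot hW this

open scoped Classical in
theorem parts_top_eq {n : ℕ} (hn : 1 ≤ n) :
    (⊤ : Finpartition (Finset.univ : Finset (Fin n))).parts = {Finset.univ} := by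
  have : Nonempty (Fin n) := ⟨⟨0, hn⟩⟩
  have h1 := Finpartition.parts_top_subset (Finset.univ : Finset (Fin n))
  have h2 : (⊤ : Finpartition (Finset.univ : Finset (Fin n))).parts.Nonempty :=
    Finpartition.parts_nonempty _ (by simpa using Finset.univ_nonempty.ne_empty)
  exact (Finset.subset_singleton_iff.1 h1).resolve_left h2.ne_empty

/-- The moment-cumulant formula. -/
theorem moment_cumulant_formula (m : ℕ → ℝ) (n : ℕ) (hn : 1 ≤ n) :
    m n = ∑ π ∈ NC n, ∏ V ∈ π.parts, freeCumulant m V.card := by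
  classical
  have htop : (⊤ : Finpartition (Finset.univ : Finset (Fin n))) ∈ NC n := by
    simp only [NC, Finset.mem_filter, Finset.mem_univ, true_and]
    intro V hV W hW hne
    rw [parts_top_eq hn, Finset.mem_singleton] at hV hW
    exact absurd (hV.trans hW.symm) hne
  rw [← Finset.add_sum_erase _ _ htop, parts_top_eq hn, Finset.prod_singleton, Finset.card_univ,
    Fintype.card_fin]
  have hrest : ∑ π ∈ (NC n).erase ⊤, ∏ V ∈ π.parts, freeCumulant m V.card =
      ∑ π ∈ (NC n).erase ⊤, ∏ V ∈ π.parts,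
        if _h : V.card < n then freeCumulant m V.card else 0 := by
    refine Finset.sum_congr rfl fun π hπ => Finset.prod_congr rfl fun V hV => ?_
    have hne : π.parts ≠ {Finset.univ} := by
      intro h
      apply (Finset.mem_erase.1 hπ).1
      apply Finpartition.ext
      rw [h, parts_top_eq hn]
    rw [dif_pos (card_lt_of_ne_top hne hV)]
  rw [hrest]
  conv_rhs => rw [freeCumulant]
  convert (sub_add_cancel (m n) _).symm

/-- The `n`-th free cumulant of a measure: the cumulant of its moment sequence. -/
noncomputable def cumulant (μ : Measure ℝ) (n : ℕ) : ℝ := freeCumulant (moment μ) n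

/-! Cauchy transform and `R`-transform. -/

/-- The Cauchy transform `G_μ(z) = ∫ 1 / (z - t) dμ(t)`. -/
noncomputable def cauchyTransform (μ : Measure ℝ) (z : ℂ) : ℂ := ∫ t : ℝ, 1 / (z - (t : ℂ)) ∂μ

/-- `R` is (a representative of the germ at `0` of) the `R`-transform of `μ`: it is analytic at `0`
and `K(z) = 1 / z + R(z)` is the inverse of the Cauchy transform for small `z ≠ 0`. Since
`K(z) → ∞` as `z → 0` and `G_μ` is injective near `∞` for compactly supported `μ`, this determines
`R` near `0`. -/
def IsRTransform (μ : Measure ℝ) (R : ℂ → ℂ) : Prop :=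
  AnalyticAt ℂ R 0 ∧ ∀ᶠ z in 𝓝[≠] (0 : ℂ), cauchyTransform μ (R z + 1 / z) = z

open scoped Classical in
/-- The `R`-transform `R_μ`; its values are meaningful near `0` only. -/
noncomputable def rTransform (μ : Measure ℝ) : ℂ → ℂ :=
  if h : ∃ R, IsRTransform μ R then h.choose else 0

/-! Non-commutative probability spaces, freeness and free convolution. -/

/-- `φ` is a state on the unital `*`-algebra `A`, so that `(A, φ)` is a `*`-probability space. -/
def IsState {A : Type*} [Ring A] [StarRing A] [Algebra ℂ A] (φ : A →ₗ[ℂ] ℂ) : Prop :=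
  φ 1 = 1 ∧ ∀ a : A, 0 ≤ φ (star a * a)

/-- Free independence of unital subalgebras: `φ (a₀ a₁ ⋯ a_k) = 0` for all centred `a_j` from the
subalgebras such that neighbouring elements come from subalgebras with different indices. -/
def FreeSubalgebras {A ι : Type*} [Ring A] [Algebra ℂ A] (φ : A →ₗ[ℂ] ℂ)
    (S : ι → Subalgebra ℂ A) : Prop :=
  ∀ (k : ℕ) (i : Fin (k + 1) → ι) (a : Fin (k + 1) → A),
    (∀ j, a j ∈ S (i j)) → (∀ j : Fin k, i j.castSucc ≠ i j.succ) → (∀ j, φ (a j) = 0) →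
      φ (List.ofFn a).prod = 0

/-- Free independence of random variables: the unital subalgebras they generate are free. -/
def FreeVariables {A ι : Type*} [Ring A] [Algebra ℂ A] (φ : A →ₗ[ℂ] ℂ) (x : ι → A) : Prop :=
  FreeSubalgebras φ fun i => Algebra.adjoin ℂ {x i}

/-- `μ` is the analytic distribution of `x`: the compactly supported probability measure on `ℝ`
with the same moments as `x`. -/
def HasAnalyticDistribution {A : Type*} [Ring A] [Algebra ℂ A] (φ : A →ₗ[ℂ] ℂ) (x : A)
    (μ : Measure ℝ) : Prop :=
  IsCompactlySupportedProb μ ∧ ∀ n : ℕ, φ (x ^ n) = (moment μ n : ℂ)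

/-- `ρ` is the distribution of `x + y` for free self-adjoint random variables `x` and `y` in some
`*`-probability space whose distributions are `μ` and `ν`. -/
def IsFreeConvolution (μ ν ρ : Measure ℝ) : Prop :=
  ∃ (A : Type) (_ : Ring A) (_ : StarRing A) (_ : Algebra ℂ A) (_ : StarModule ℂ A)
    (φ : A →ₗ[ℂ] ℂ) (x y : A),
    IsState φ ∧ IsSelfAdjoint x ∧ IsSelfAdjoint y ∧ FreeVariables φ ![x, y] ∧
      HasAnalyticDistribution φ x μ ∧ HasAnalyticDistribution φ y ν ∧
      HasAnalyticDistribution φ (x + y) ρ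

open scoped Classical in
/-- The free convolution `μ ⊞ ν` of compactly supported probability measures (the zero measure,
which is not a probability measure, if no distribution as in `IsFreeConvolution` exists). -/
noncomputable def freeConvolution (μ ν : Measure ℝ) : Measure ℝ :=
  if h : ∃ ρ, IsFreeConvolution μ ν ρ then h.choose else 0

end FreeProb

open FreeProb

/-!
For a random variable `x` in an algebra with a linear functional `φ`, let `C(z) = 1 + z R(z)` be
its cumulant series, with the `R`-transform `R`. Everything rests on the following reformulation
(`HasCumulantSeries`, `hasCumulantSeries_iff`): `C` is the formal power series with constant term
`1` for which the formal inverse of `C - X x` has expectation `1`. Moments and cumulant series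
determine each other, and the moments are polynomials in the coefficients of `C`.

If `C - X x = (1 + a)⁻¹` for the cumulant series `C` of `x`, then all coefficients of `a` are
centred elements of the algebra generated by `x`. Two factorizations and a Neumann expansion, in
which freeness kills all terms but one, then give

* `HasCumulantSeries.add`: if `x` and `y` are free with cumulant series `C` and `C'`, then `x + y`
  has cumulant series `C + C' - 1`, that is, `R`-transforms add up;
* `HasCumulantSeries.compression`: if `p` is a projection with `φ p = 1 / t` that is free from
  `x`, then `t p x p`, in the algebra compressed by `p`, has cumulant series `1 + t (C - 1)`, that
  is, its `R`-transform is `t R`.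

Hence `μ_t` is the distribution of `t p x p`, where `x` has distribution `μ`. It remains to have
free variables with given distributions in a Hilbert space, which also provides the free
convolution. The multiplication operators on `L²(μ)` and `L²(ν)` act on the free product Hilbert
space, which has an orthonormal basis of alternating words, and are free in the vacuum state
(`freeSubalgebras_freeRep`, `exists_free_operators`). Distributions of self-adjoint operators in
vector states come from the continuous functional calculus and the Riesz–Markov–Kakutani theorem
(`exists_measure_moment_eq_vectorState`).

On the analytic side, the `R`-transform exists by the inverse function theorem
(`exists_isRTransform`), and `1 + z R(z)` has the cumulant series as its Taylor series
(`IsRTransform.hasCumulantSeries`), so the formal identities determine the germ of the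
`R`-transform. Continuity of moments and cumulants in `t` holds since they are given by recursions
with polynomial dependence on the coefficients of `1 + t (C - 1)`.
-/

namespace FreeProb

open scoped InnerProductSpace ENNReal PowerSeries Polynomial

/-! ### Cumulant series -/

/-- `C` is the cumulant series of the moment sequence `m`: formally, `C(z) = 1 + z R(z)` with the
`R`-transform `R` of `m`. For a random variable `x` with moments `φ (x ^ k) = m k`, the coefficients
of `φ ((C - X x)⁻¹) = ∑ k, m k X ^ k C⁻¹ ^ (k + 1)` are those of the constant series `1`. -/
def HasCumulantSeries (m : ℕ → ℂ) (C : ℂ⟦X⟧) : Prop :=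
  PowerSeries.constantCoeff C = 1 ∧ ∀ n : ℕ,
    ∑ k ∈ Finset.range (n + 1), m k * PowerSeries.coeff (n - k) (C⁻¹ ^ (k + 1)) =
      if n = 0 then 1 else 0

theorem HasCumulantSeries.zero {m : ℕ → ℂ} {C : ℂ⟦X⟧} (h : HasCumulantSeries m C) : m 0 = 1 := by
  have := h.2 0
  simpa [h.1] using this

/-- The cumulant series determines the moments: the term with `k = n` of the `n`-th equation
is `m n`. -/
theorem HasCumulantSeries.moment_eq {m : ℕ → ℂ} {C : ℂ⟦X⟧} (h : HasCumulantSeries m C) {n : ℕ}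
    (hn : n ≠ 0) :
    m n = -∑ k ∈ Finset.range n, m k * PowerSeries.coeff (n - k) (C⁻¹ ^ (k + 1)) := by
  have := h.2 n
  rw [Finset.sum_range_succ, if_neg hn] at this
  simp only [Nat.sub_self, PowerSeries.coeff_zero_eq_constantCoeff, map_pow,
    PowerSeries.constantCoeff_inv, h.1, inv_one, one_pow, mul_one] at this
  linear_combination this

theorem HasCumulantSeries.moments_unique {m m' : ℕ → ℂ} {C : ℂ⟦X⟧} (h : HasCumulantSeries m C)
    (h' : HasCumulantSeries m' C) : m = m' := by
  ext n
  induction n using Nat.strong_induction_on with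
  | _ n ih =>
    by_cases hn : n = 0
    · rw [hn, h.zero, h'.zero]
    · rw [h.moment_eq hn, h'.moment_eq hn]
      congr 1
      exact Finset.sum_congr rfl fun k hk => by rw [ih k (Finset.mem_range.1 hk)]

/-- The moments determine the cumulant series: the term with `k = 0` of the `n`-th equation is the
`n`-th coefficient of `C⁻¹`, and the other terms involve lower coefficients only. -/
theorem HasCumulantSeries.unique {m : ℕ → ℂ} {C C' : ℂ⟦X⟧} (h : HasCumulantSeries m C)
    (h' : HasCumulantSeries m C') : C = C' := by
  have key : ∀ n : ℕ, (PowerSeries.X : ℂ⟦X⟧) ^ n ∣ C⁻¹ - C'⁻¹ := by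
    intro n
    induction n with
    | zero => simp
    | succ n ih =>
      have hpow : ∀ k i, i < n →
          PowerSeries.coeff i (C⁻¹ ^ k) = PowerSeries.coeff i (C'⁻¹ ^ k) := by
        intro k i hi
        have := (ih.trans (sub_dvd_pow_sub_pow C⁻¹ C'⁻¹ k))
        rw [PowerSeries.X_pow_dvd_iff] at this
        simpa [sub_eq_zero] using this i hi
      rw [PowerSeries.X_pow_dvd_iff] at ih ⊢
      intro i hi
      rcases (Nat.lt_succ_iff.1 hi).lt_or_eq with hi | rfl
      · exact ih i hi
      · have e := (h.2 i).trans (h'.2 i).symm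
        rw [Finset.sum_range_succ', Finset.sum_range_succ'] at e
        have e2 : ∀ k ∈ Finset.range i,
            m (k + 1) * PowerSeries.coeff (i - (k + 1)) (C⁻¹ ^ (k + 1 + 1)) =
            m (k + 1) * PowerSeries.coeff (i - (k + 1)) (C'⁻¹ ^ (k + 1 + 1)) := by
          intro k hk
          have := Finset.mem_range.1 hk
          rw [hpow _ _ (by omega)]
        rw [Finset.sum_congr rfl e2, h.zero] at e
        simpa [sub_eq_zero] using e
  have hinv : C⁻¹ = C'⁻¹ := by
    ext n
    have := PowerSeries.X_pow_dvd_iff.1 (key (n + 1)) n (Nat.lt_succ_self n)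
    simpa [sub_eq_zero] using this
  calc C = C * (C'⁻¹ * C') := by rw [PowerSeries.inv_mul_cancel _ (by simp [h'.1]), mul_one]
    _ = C' := by rw [← hinv, ← mul_assoc, PowerSeries.mul_inv_cancel _ (by simp [h.1]), one_mul]

theorem continuous_coeff_inv {C : ℝ → ℂ⟦X⟧} (h1 : ∀ t, PowerSeries.constantCoeff (C t) = 1)
    (hC : ∀ n, Continuous fun t => PowerSeries.coeff n (C t)) (n : ℕ) :
    Continuous fun t => PowerSeries.coeff n (C t)⁻¹ := by
  induction n using Nat.strong_induction_on with
  | _ n ih =>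
    have e : ∀ t, PowerSeries.coeff n (C t)⁻¹ = _ := fun t => PowerSeries.coeff_inv n (C t)
    simp only [e, h1]
    by_cases hn : n = 0
    · simp only [hn, if_true]; exact continuous_const
    · simp only [hn, if_false]
      refine continuous_const.mul (continuous_finsetSum _ fun x _ => ?_)
      by_cases hx : x.2 < n
      · simp only [hx, if_true]; exact (hC _).mul (ih _ hx)
      · simp only [hx, if_false]; exact continuous_const

theorem continuous_coeff_pow {D : ℝ → ℂ⟦X⟧}
    (hD : ∀ n, Continuous fun t => PowerSeries.coeff n (D t)) (k n : ℕ) :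
    Continuous fun t => PowerSeries.coeff n (D t ^ k) := by
  induction k generalizing n with
  | zero => simp only [pow_zero]; exact continuous_const
  | succ k ih =>
    simp only [pow_succ, PowerSeries.coeff_mul]
    exact continuous_finsetSum _ fun x _ => (ih _).mul (hD _)

theorem continuousOn_of_hasCumulantSeries {m : ℝ → ℕ → ℂ} {C : ℝ → ℂ⟦X⟧} {s : Set ℝ}
    (h1 : ∀ t, PowerSeries.constantCoeff (C t) = 1)
    (hC : ∀ n, Continuous fun t => PowerSeries.coeff n (C t))
    (hm : ∀ t ∈ s, HasCumulantSeries (m t) (C t)) (n : ℕ) :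
    ContinuousOn (fun t => m t n) s := by
  induction n using Nat.strong_induction_on with
  | _ n ih =>
    by_cases hn : n = 0
    · exact continuousOn_const.congr fun t ht => by rw [hn, (hm t ht).zero]
    · refine ContinuousOn.congr (ContinuousOn.neg (continuousOn_finsetSum _ fun k hk =>
        (ih k (Finset.mem_range.1 hk)).mul
          (continuous_coeff_pow (continuous_coeff_inv h1 hC) (k + 1) (n - k)).continuousOn))
        fun t ht => (hm t ht).moment_eq hn

/-- The free cumulants are polynomials in the moments. -/
theorem continuousOn_freeCumulant {m : ℝ → ℕ → ℝ} {s : Set ℝ}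
    (hm : ∀ n, ContinuousOn (fun t => m t n) s) (n : ℕ) :
    ContinuousOn (fun t => freeCumulant (m t) n) s := by
  classical
  induction n using Nat.strong_induction_on with
  | _ n ih =>
    simp only [fun t => freeCumulant.eq_1 (m t) n]
    refine (hm n).sub (continuousOn_finsetSum _ fun π _ => continuousOn_finsetProd _ fun V _ => ?_)
    by_cases h : V.card < n
    · simp only [h, dite_true]; exact ih _ h
    · simp only [h, dite_false]; exact continuousOn_const

/-! ### Freeness in terms of submodules of centred elements -/

section Centred

variable {A ι : Type*} [Ring A] [Algebra ℂ A] {φ : A →ₗ[ℂ] ℂ} {S : ι → Subalgebra ℂ A}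

/-- The centred elements of the subalgebra `S`. -/
def centred (φ : A →ₗ[ℂ] ℂ) (S : Subalgebra ℂ A) : Submodule ℂ A :=
  Subalgebra.toSubmodule S ⊓ LinearMap.ker φ

/-- Products of submodules are spanned by products of elements. -/
theorem prod_centred_le_span (l : List ι) :
    (l.map fun i => centred φ (S i)).prod ≤ Submodule.span ℂ
      {x | ∃ a : Fin l.length → A, (∀ j, a j ∈ centred φ (S (l.get j))) ∧
        x = (List.ofFn a).prod} := by
  induction l with
  | nil =>
    rw [List.map_nil, List.prod_nil, Submodule.one_eq_span]
    exact Submodule.span_mono fun x hx => ⟨Fin.elim0, fun j => j.elim0, by simpa using hx⟩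
  | cons i l ih =>
    rw [List.map_cons, List.prod_cons, Submodule.mul_le]
    intro m hm n hn
    refine Submodule.span_induction ?_ ?_ ?_ ?_ (ih hn)
    · rintro x ⟨a, ha, rfl⟩
      refine Submodule.subset_span ⟨Fin.cons m a, fun j => ?_, ?_⟩
      · refine Fin.cases ?_ (fun j => ?_) j
        · simpa using hm
        · simpa using ha j
      · exact (by simp [List.ofFn_succ] : m * (List.ofFn a).prod =
          (List.ofFn (Fin.cons m a : Fin (l.length + 1) → A)).prod)
    · simp
    · intro x y _ _ hx hy
      rw [mul_add]; exact Submodule.add_mem _ hx hy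
    · intro c x _ hx
      rw [mul_smul_comm]; exact Submodule.smul_mem _ _ hx

/-- A state vanishes on products of centred elements along a nonempty alternating list of free
subalgebras. -/
theorem FreeSubalgebras.prod_centred_le_ker (hS : FreeSubalgebras φ S) {l : List ι} (hl : l ≠ [])
    (hc : l.IsChain (· ≠ ·)) :
    (l.map fun i => centred φ (S i)).prod ≤ LinearMap.ker φ := by
  refine (prod_centred_le_span l).trans (Submodule.span_le.2 ?_)
  rintro x ⟨a, ha, rfl⟩
  obtain ⟨i, l', rfl⟩ := List.exists_cons_of_ne_nil hl
  refine LinearMap.mem_ker.2 (hS l'.length (fun j => (i :: l').get j) a (fun j => (ha j).1)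
    (fun j => ?_) fun j => LinearMap.mem_ker.1 (ha j).2)
  have := List.isChain_iff_getElem.1 hc j.1 (by simp)
  simpa using this

/-- The alternating words in two letters `i` and `j` that start with `i`: a power of `i j`
followed by a shorter alternating word. -/
theorem FreeSubalgebras.pow_mul_prod_le_ker (hS : FreeSubalgebras φ S) {i j : ι} (hij : i ≠ j)
    {l : List ι} (hl : (i :: l).IsChain (· ≠ ·)) (k : ℕ) :
    (centred φ (S i) * centred φ (S j)) ^ k *
      ((i :: l).map fun i => centred φ (S i)).prod ≤ LinearMap.ker φ := by
  have : ∃ l', (i :: l').IsChain (· ≠ ·) ∧ ((i :: l').map fun i => centred φ (S i)).prod =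
      (centred φ (S i) * centred φ (S j)) ^ k *
        ((i :: l).map fun i => centred φ (S i)).prod := by
    induction k with
    | zero => exact ⟨l, hl, by simp⟩
    | succ k ih =>
      obtain ⟨l', h1, h2⟩ := ih
      refine ⟨j :: i :: l', ?_, ?_⟩
      · rw [List.isChain_cons_cons, List.isChain_cons_cons]
        exact ⟨hij, hij.symm, h1⟩
      · rw [List.map_cons, List.map_cons, List.prod_cons, List.prod_cons, h2, pow_succ']
        simp only [mul_assoc]
  obtain ⟨l', h1, h2⟩ := this
  rw [← h2]
  exact hS.prod_centred_le_ker (by simp) h1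

theorem FreeSubalgebras.pow_mul_le_ker (hS : FreeSubalgebras φ S) {i j : ι} (hij : i ≠ j) (k : ℕ) :
    (centred φ (S i) * centred φ (S j)) ^ k * centred φ (S i) ≤ LinearMap.ker φ := by
  simpa using hS.pow_mul_prod_le_ker hij (l := []) (by simp) k

theorem FreeSubalgebras.pow_succ_le_ker (hS : FreeSubalgebras φ S) {i j : ι} (hij : i ≠ j)
    (k : ℕ) : (centred φ (S i) * centred φ (S j)) ^ (k + 1) ≤ LinearMap.ker φ := by
  simpa [pow_succ] using hS.pow_mul_prod_le_ker hij (l := [j]) (by simpa using hij) k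

end Centred

/-! ### Power series with noncommuting coefficients -/

section Series

variable {A : Type*} [Ring A]

/-- Neumann series: if `(1 - w) V = 1` and `w` has no constant term, then `V = ∑ k, w ^ k`
coefficientwise. -/
theorem coeff_mul_mul_of_one_sub_mul {w V : A⟦X⟧} (hw : PowerSeries.constantCoeff w = 0)
    (hV : (1 - w) * V = 1) (u v : A⟦X⟧) (n : ℕ) :
    PowerSeries.coeff n (u * V * v) =
      ∑ k ∈ Finset.range (n + 1), PowerSeries.coeff n (u * w ^ k * v) := by
  have h1 : V = ∑ k ∈ Finset.range (n + 1), w ^ k + w ^ (n + 1) * V := by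
    have : (∑ k ∈ Finset.range (n + 1), w ^ k) * ((1 - w) * V) = (1 - w ^ (n + 1)) * V := by
      rw [← mul_assoc, geom_sum_mul_neg]
    rw [hV, mul_one, sub_mul, one_mul] at this
    rw [this]; abel
  obtain ⟨w', rfl⟩ : ∃ w', w = PowerSeries.X * w' :=
    ⟨_, by simpa [hw] using PowerSeries.sub_const_eq_X_mul_shift w⟩
  have h2 : u * ((PowerSeries.X * w') ^ (n + 1) * V) * v =
      PowerSeries.X ^ (n + 1) * (u * (w' ^ (n + 1) * V) * v) := by
    rw [(PowerSeries.commute_X w').symm.mul_pow]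
    have := (PowerSeries.commute_X u).pow_right (n + 1)
    simp only [← mul_assoc]
    rw [this.eq]
  conv_lhs => rw [h1]
  rw [mul_add, add_mul, map_add, h2, PowerSeries.coeff_X_pow_mul', if_neg (by omega), add_zero,
    Finset.mul_sum, Finset.sum_mul, map_sum]

/-- All coefficients of the power series `f` lie in the submodule `Z`. -/
def CoeffsMem {A : Type*} [Ring A] [Algebra ℂ A] (Z : Submodule ℂ A) (f : A⟦X⟧) : Prop :=
  ∀ n, PowerSeries.coeff n f ∈ Z

variable [Algebra ℂ A] {P Q : Submodule ℂ A} {f g : A⟦X⟧}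

theorem CoeffsMem.mul (hf : CoeffsMem P f) (hg : CoeffsMem Q g) : CoeffsMem (P * Q) (f * g) := by
  intro n
  rw [PowerSeries.coeff_mul]
  exact Submodule.sum_mem _ fun x _ => Submodule.mul_mem_mul (hf _) (hg _)

theorem CoeffsMem.one : CoeffsMem (1 : Submodule ℂ A) (1 : A⟦X⟧) := by
  intro n
  rw [PowerSeries.coeff_one]
  split_ifs
  · exact Submodule.one_le.1 le_rfl
  · exact Submodule.zero_mem _

theorem CoeffsMem.pow (hf : CoeffsMem P f) (k : ℕ) : CoeffsMem (P ^ k) (f ^ k) := by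
  induction k with
  | zero => simpa using CoeffsMem.one
  | succ k ih => rw [pow_succ, pow_succ]; exact ih.mul hf

theorem CoeffsMem.C {x : A} (hx : x ∈ P) : CoeffsMem P (PowerSeries.C x) := by
  intro n
  rw [PowerSeries.coeff_C]
  split_ifs
  · exact hx
  · exact Submodule.zero_mem _

theorem CoeffsMem.map_eq_zero {φ : A →ₗ[ℂ] ℂ} (hf : CoeffsMem P f) (hP : P ≤ LinearMap.ker φ)
    (n : ℕ) : φ (PowerSeries.coeff n f) = 0 :=
  LinearMap.mem_ker.1 (hP (hf n))

theorem map_algebraMap_commute (f : ℂ⟦X⟧) (g : A⟦X⟧) :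
    Commute (PowerSeries.map (algebraMap ℂ A) f) g := by
  ext n
  rw [PowerSeries.coeff_mul, PowerSeries.coeff_mul,
    ← Finset.Nat.sum_antidiagonal_swap]
  refine Finset.sum_congr rfl fun x _ => ?_
  simp only [PowerSeries.coeff_map, Prod.fst_swap, Prod.snd_swap]
  exact Algebra.commutes _ _

/-- The seriesResolvent `(C - X x)⁻¹` for a scalar power series `C` with constant term `1`. -/
noncomputable def seriesResolvent (C : ℂ⟦X⟧) (x : A) : A⟦X⟧ :=
  PowerSeries.invOfUnit
    (PowerSeries.map (algebraMap ℂ A) C - PowerSeries.X * PowerSeries.C x) 1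

variable {C : ℂ⟦X⟧}

theorem constantCoeff_denominator (hC : PowerSeries.constantCoeff C = 1) (x : A) :
    PowerSeries.constantCoeff
      (PowerSeries.map (algebraMap ℂ A) C - PowerSeries.X * PowerSeries.C x) = ((1 : Aˣ) : A) := by
  have h : PowerSeries.constantCoeff (PowerSeries.map (algebraMap ℂ A) C) = 1 := by
    rw [← PowerSeries.coeff_zero_eq_constantCoeff_apply, PowerSeries.coeff_map,
      PowerSeries.coeff_zero_eq_constantCoeff_apply, hC, map_one]
  simp [h]

theorem mul_seriesResolvent (hC : PowerSeries.constantCoeff C = 1) (x : A) :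
    (PowerSeries.map (algebraMap ℂ A) C - PowerSeries.X * PowerSeries.C x) *
      seriesResolvent C x = 1 :=
  PowerSeries.mul_invOfUnit _ _ (constantCoeff_denominator hC x)

theorem seriesResolvent_mul (hC : PowerSeries.constantCoeff C = 1) (x : A) :
    seriesResolvent C x *
      (PowerSeries.map (algebraMap ℂ A) C - PowerSeries.X * PowerSeries.C x) = 1 :=
  PowerSeries.invOfUnit_mul _ _ (constantCoeff_denominator hC x)

theorem constantCoeff_seriesResolvent (C : ℂ⟦X⟧) (x : A) :
    PowerSeries.constantCoeff (seriesResolvent C x) = 1 := by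
  simp [seriesResolvent]

/-- The geometric series `(C - X x)⁻¹ = ∑ k, X ^ k C⁻¹ ^ (k + 1) x ^ k`. -/
theorem coeff_seriesResolvent (hC : PowerSeries.constantCoeff C = 1) (x : A) (n : ℕ) :
    PowerSeries.coeff n (seriesResolvent C x) =
      ∑ k ∈ Finset.range (n + 1), PowerSeries.coeff (n - k) (C⁻¹ ^ (k + 1)) • x ^ k := by
  set D : A⟦X⟧ := PowerSeries.map (algebraMap ℂ A) C⁻¹ with hD
  set C' : A⟦X⟧ := PowerSeries.map (algebraMap ℂ A) C with hC'
  have hDC : D * C' = 1 := by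
    rw [hD, hC', ← map_mul, PowerSeries.inv_mul_cancel _ (by simp [hC]), map_one]
  have hCD : C' * D = 1 := by
    rw [hD, hC', ← map_mul, PowerSeries.mul_inv_cancel _ (by simp [hC]), map_one]
  have hcom : Commute D (PowerSeries.X * PowerSeries.C x) := map_algebraMap_commute _ _
  have h1 : (1 - PowerSeries.X * PowerSeries.C x * D) * (C' * seriesResolvent C x) = 1 := by
    rw [← mul_assoc, sub_mul, one_mul, mul_assoc _ D, hDC, mul_one]
    exact mul_seriesResolvent hC x
  have h2 : seriesResolvent C x = D * (C' * seriesResolvent C x) * 1 := by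
    rw [mul_one, ← mul_assoc, hDC, one_mul]
  rw [h2, coeff_mul_mul_of_one_sub_mul (by simp) h1]
  refine Finset.sum_congr rfl fun k hk => ?_
  rw [mul_one, hcom.symm.mul_pow, (hcom.pow_right k).left_comm, ← pow_succ',
    (PowerSeries.commute_X (PowerSeries.C x)).symm.mul_pow, mul_assoc,
    PowerSeries.coeff_X_pow_mul', if_pos (Nat.lt_succ_iff.1 (Finset.mem_range.1 hk)), ← map_pow,
    PowerSeries.coeff_C_mul, hD, ← map_pow, PowerSeries.coeff_map, ← Algebra.commutes,
    Algebra.smul_def]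

/-- The cumulant series of `x` is the series `C` for which `(C - X x)⁻¹` has expectation `1`. -/
theorem hasCumulantSeries_iff (φ : A →ₗ[ℂ] ℂ) (hC : PowerSeries.constantCoeff C = 1) (x : A) :
    HasCumulantSeries (fun k => φ (x ^ k)) C ↔
      ∀ n, φ (PowerSeries.coeff n (seriesResolvent C x)) = if n = 0 then 1 else 0 := by
  simp only [HasCumulantSeries, hC, true_and, coeff_seriesResolvent hC, map_sum, map_smul,
    smul_eq_mul, mul_comm]

/-- `(C - X x)⁻¹ - 1` is centred if `C` is the cumulant series of `x`. -/
theorem HasCumulantSeries.coeffsMem_centred {φ : A →ₗ[ℂ] ℂ} (hφ : φ 1 = 1) {x : A}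
    {S : Subalgebra ℂ A} (hx : x ∈ S) (h : HasCumulantSeries (fun k => φ (x ^ k)) C) :
    CoeffsMem (centred φ S) (seriesResolvent C x - 1) := by
  intro n
  have h' := (hasCumulantSeries_iff φ h.1 x).1 h n
  refine ⟨?_, ?_⟩
  · rw [map_sub, coeff_seriesResolvent h.1]
    refine sub_mem (Subalgebra.sum_mem _ fun k _ => S.smul_mem (S.pow_mem hx k) _) ?_
    rw [PowerSeries.coeff_one]
    split_ifs
    · exact S.one_mem
    · exact S.zero_mem
  · refine LinearMap.mem_ker.2 ?_
    rw [map_sub, map_sub, h', PowerSeries.coeff_one]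
    split_ifs <;> simp [hφ]

end Series

/-! ### Sums of free variables -/

section Additivity

variable {A : Type*} [Ring A] [Algebra ℂ A] {φ : A →ₗ[ℂ] ℂ} {S : Fin 2 → Subalgebra ℂ A}

theorem mul_mul_pow_comm {M : Type*} [Monoid M] (a b : M) (k : ℕ) :
    b * (a * b) ^ k = (b * a) ^ k * b := by
  induction k with
  | zero => simp
  | succ k ih => rw [pow_succ, ← mul_assoc, ih, pow_succ]; simp only [mul_assoc]

/-- Additivity of the `R`-transform: with `C - X x = (1 + a)⁻¹` and `C' - X y = (1 + b)⁻¹`, where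
`a` and `b` are centred, one has `(C + C' - 1) - X (x + y) = (1 + a)⁻¹ (1 - a b) (1 + b)⁻¹`, and in
the Neumann expansion of the inverse of this product all terms but `1` are alternating. -/
theorem HasCumulantSeries.add (hφ : φ 1 = 1) (hS : FreeSubalgebras φ S) {x y : A}
    (hx : x ∈ S 0) (hy : y ∈ S 1) {C C' : ℂ⟦X⟧} (h : HasCumulantSeries (fun k => φ (x ^ k)) C)
    (h' : HasCumulantSeries (fun k => φ (y ^ k)) C') :
    HasCumulantSeries (fun k => φ ((x + y) ^ k)) (C + C' - 1) := by
  have hC : PowerSeries.constantCoeff (C + C' - 1) = 1 := by simp [h.1, h'.1]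
  rw [hasCumulantSeries_iff φ hC]
  set a := seriesResolvent C x - 1 with ha
  set b := seriesResolvent C' y - 1 with hb
  have haZ : CoeffsMem (centred φ (S 0)) a := h.coeffsMem_centred hφ hx
  have hbZ : CoeffsMem (centred φ (S 1)) b := h'.coeffsMem_centred hφ hy
  set U := PowerSeries.map (algebraMap ℂ A) C - PowerSeries.X * PowerSeries.C x
  set U' := PowerSeries.map (algebraMap ℂ A) C' - PowerSeries.X * PowerSeries.C y
  have e1 : U * (1 + a) = 1 := by rw [ha, add_sub_cancel]; exact mul_seriesResolvent h.1 x
  have e2 : (1 + b) * U' = 1 := by rw [hb, add_sub_cancel]; exact seriesResolvent_mul h'.1 y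
  have e4 : U' * (1 + b) = 1 := by rw [hb, add_sub_cancel]; exact mul_seriesResolvent h'.1 y
  have ha0 : PowerSeries.constantCoeff a = 0 := by simp [ha, constantCoeff_seriesResolvent]
  have hw : PowerSeries.constantCoeff (a * b) = 0 := by simp [ha0]
  have hw1 : PowerSeries.constantCoeff (1 - a * b) = ((1 : Aˣ) : A) := by simp [ha0]
  set V := PowerSeries.invOfUnit (1 - a * b) 1
  have hV : (1 - a * b) * V = 1 := PowerSeries.mul_invOfUnit _ _ hw1
  have hfac : PowerSeries.map (algebraMap ℂ A) (C + C' - 1) - PowerSeries.X * PowerSeries.C (x + y)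
      = U * (1 - a * b) * U' := by
    have : U * (a * b) * U' = (1 - U) * (1 - U') := by
      have e5 : U * a = 1 - U := by rw [← e1]; noncomm_ring
      have e6 : b * U' = 1 - U' := by rw [← e2]; noncomm_ring
      rw [← mul_assoc, e5, mul_assoc, e6]
    have e7 : U * (1 - a * b) * U' = U * U' - (1 - U) * (1 - U') := by rw [← this]; noncomm_ring
    rw [e7, map_sub, map_add, map_add, map_one]
    simp only [U, U']
    noncomm_ring
  have hres : seriesResolvent (C + C' - 1) (x + y) = (1 + b) * V * (1 + a) := by
    refine left_inv_eq_right_inv (seriesResolvent_mul hC (x + y)) ?_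
    rw [hfac]
    calc U * (1 - a * b) * U' * ((1 + b) * V * (1 + a))
        = U * ((1 - a * b) * (U' * (1 + b)) * V) * (1 + a) := by simp only [mul_assoc]
      _ = 1 := by rw [e4, mul_one, hV, mul_one, e1]
  intro n
  have hpow : ∀ k, CoeffsMem ((centred φ (S 0) * centred φ (S 1)) ^ k) ((a * b) ^ k) :=
    (haZ.mul hbZ).pow
  have hsplit : ∀ k, (1 + b) * (a * b) ^ k * (1 + a) =
      (a * b) ^ k + (a * b) ^ k * a + (b * a) ^ k * b + (b * a) ^ (k + 1) := by
    intro k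
    rw [pow_succ (b * a), ← mul_assoc ((b * a) ^ k), ← mul_mul_pow_comm a b]
    noncomm_ring
  have h01 : (0 : Fin 2) ≠ 1 := by decide
  have hterm : ∀ k, φ (PowerSeries.coeff n ((1 + b) * (a * b) ^ k * (1 + a))) =
      φ (PowerSeries.coeff n ((a * b) ^ k)) := by
    intro k
    rw [hsplit, map_add, map_add, map_add, map_add, map_add, map_add,
      ((hpow k).mul haZ).map_eq_zero (hS.pow_mul_le_ker h01 k),
      (((hbZ.mul haZ).pow k).mul hbZ).map_eq_zero (hS.pow_mul_le_ker h01.symm k),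
      ((hbZ.mul haZ).pow (k + 1)).map_eq_zero (hS.pow_succ_le_ker h01.symm k)]
    simp
  rw [hres, coeff_mul_mul_of_one_sub_mul hw hV, map_sum, Finset.sum_range_succ',
    Finset.sum_eq_zero, zero_add, hterm, pow_zero, PowerSeries.coeff_one]
  · split_ifs <;> simp [hφ]
  · intro k _
    rw [hterm, (hpow (k + 1)).map_eq_zero (hS.pow_succ_le_ker h01 k)]

end Additivity

/-! ### Compression by a free projection -/

section Compression

variable {A : Type*} [Ring A] [Algebra ℂ A] {φ : A →ₗ[ℂ] ℂ} {S : Fin 2 → Subalgebra ℂ A}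

/-- Compression by a free projection `p` with `φ p = α`: in the compressed space, with the state
`b ↦ α⁻¹ φ (p b p)`, the variable `α⁻¹ p x p` has `R`-transform `α⁻¹ R_x`. Writing
`C - X x = (1 + a)⁻¹` with `a` centred and `p° = p - α`, one has
`p (C - X x) - p + α = (α - p° a) (1 + a)⁻¹`, and on the range of `p` the left-hand side is
`(C + α - 1) - X p x p`. -/
theorem HasCumulantSeries.compression (hφ : φ 1 = 1) (hS : FreeSubalgebras φ S) {x p : A}
    (hx : x ∈ S 0) (hp : p ∈ S 1) (hpp : p * p = p) {α : ℂ} (hα : α ≠ 0) (hφp : φ p = α)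
    {C : ℂ⟦X⟧} (h : HasCumulantSeries (fun k => φ (x ^ k)) C) :
    HasCumulantSeries (fun k => α⁻¹ * φ (p * (α⁻¹ • (p * x * p)) ^ k * p))
      (1 + α⁻¹ • (C - 1)) := by
  have hC : PowerSeries.constantCoeff (1 + α⁻¹ • (C - 1)) = 1 := by
    rw [map_add, ← PowerSeries.coeff_zero_eq_constantCoeff_apply (α⁻¹ • (C - 1)),
      PowerSeries.coeff_smul]
    simp [h.1]
  let ψ : A →ₗ[ℂ] ℂ := α⁻¹ • (φ ∘ₗ LinearMap.mulRight ℂ p ∘ₗ LinearMap.mulLeft ℂ p)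
  have hψ : ∀ b, ψ b = α⁻¹ * φ (p * b * p) := fun b => rfl
  set T := α⁻¹ • (p * x * p) with hT
  simp only [← hψ]
  rw [hasCumulantSeries_iff ψ hC]
  set a := seriesResolvent C x - 1 with ha
  set P : A⟦X⟧ := PowerSeries.C p with hP
  set c : A⟦X⟧ := PowerSeries.C (algebraMap ℂ A α) with hc
  set c' : A⟦X⟧ := PowerSeries.C (algebraMap ℂ A α⁻¹) with hc'
  have hcc : c' * c = 1 := by
    rw [hc, hc', ← map_mul, ← map_mul, inv_mul_cancel₀ hα, map_one, map_one]
  have hcom : ∀ f, Commute c f := fun f => by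
    rw [hc, ← PowerSeries.map_C]; exact map_algebraMap_commute _ f
  have hcom' : ∀ f, Commute c' f := fun f => by
    rw [hc', ← PowerSeries.map_C]; exact map_algebraMap_commute _ f
  have hPP : P * P = P := by rw [hP, ← map_mul, hpp]
  set q := P - c with hq
  have haZ : CoeffsMem (centred φ (S 0)) a := h.coeffsMem_centred hφ hx
  have hqZ : CoeffsMem (centred φ (S 1)) q := by
    rw [hq, hP, hc, ← map_sub]
    refine CoeffsMem.C ⟨sub_mem hp ((S 1).algebraMap_mem α), LinearMap.mem_ker.2 ?_⟩
    rw [map_sub, hφp, Algebra.algebraMap_eq_smul_one, map_smul, hφ, smul_eq_mul, mul_one, sub_self]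
  set U := PowerSeries.map (algebraMap ℂ A) C - PowerSeries.X * PowerSeries.C x with hU
  have e3 : (1 + a) * U = 1 := by rw [ha, add_sub_cancel]; exact seriesResolvent_mul h.1 x
  have ha0 : PowerSeries.constantCoeff a = 0 := by simp [ha, constantCoeff_seriesResolvent]
  set w := c' * (q * a) with hw
  have hw0 : PowerSeries.constantCoeff w = 0 := by simp [hw, ha0]
  have hw1 : PowerSeries.constantCoeff (1 - w) = ((1 : Aˣ) : A) := by simp [hw0]
  set V := PowerSeries.invOfUnit (1 - w) 1
  have hV : (1 - w) * V = 1 := PowerSeries.mul_invOfUnit _ _ hw1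
  have hV' : V * (1 - w) = 1 := PowerSeries.invOfUnit_mul _ _ hw1
  -- `L = p (C - X x) - p + α` factors through `1 - w = 1 - α⁻¹ p° a`, hence is invertible.
  set L := P * U - P + c with hL
  have hfac : L = c * (1 - w) * U := by
    have e5 : a * U = 1 - U := by rw [← e3]; noncomm_ring
    have e6 : c * w = q * a := by rw [hw, ← mul_assoc, (hcom c').eq, hcc, one_mul]
    have e7 : c * (1 - w) * U = c * U - q * (1 - U) := by
      rw [mul_sub c, e6, mul_one, sub_mul c, mul_assoc q, e5]
    rw [e7, hq, hL]
    noncomm_ring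
  have hinv : (1 + a) * V * c' * L = 1 := by
    rw [hfac]
    calc (1 + a) * V * c' * (c * (1 - w) * U)
        = (1 + a) * (V * ((c' * c) * (1 - w))) * U := by simp only [mul_assoc]
      _ = 1 := by rw [hcc, one_mul, hV', mul_one, e3]
  set Rt := seriesResolvent (1 + α⁻¹ • (C - 1)) T with hRt
  set Ut := PowerSeries.map (algebraMap ℂ A) (1 + α⁻¹ • (C - 1)) -
    PowerSeries.X * PowerSeries.C T with hUt
  have hsm : ∀ b : A, PowerSeries.C (α⁻¹ • b) = c' * PowerSeries.C b := fun b => by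
    rw [hc', ← map_mul, Algebra.smul_def]
  have hUt' : c * Ut = PowerSeries.map (algebraMap ℂ A) C - 1 + c -
      PowerSeries.X * (P * PowerSeries.C x * P) := by
    have e8 : PowerSeries.map (algebraMap ℂ A) (1 + α⁻¹ • (C - 1)) =
        1 + c' * (PowerSeries.map (algebraMap ℂ A) C - 1) := by
      rw [map_add, map_one, PowerSeries.smul_eq_C_mul, map_mul, PowerSeries.map_C, map_sub, map_one]
    have e9 : c * c' = 1 := by rw [(hcom c').eq, hcc]
    rw [hUt, e8, hT, hsm, mul_sub, mul_add, ← mul_assoc, e9, ← mul_assoc PowerSeries.X,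
      ← (hcom' PowerSeries.X).eq, mul_assoc, ← mul_assoc c, e9, map_mul, map_mul]
    noncomm_ring
  have hXP : P * PowerSeries.X = PowerSeries.X * P := (PowerSeries.commute_X P).eq
  have hmP : P * PowerSeries.map (algebraMap ℂ A) C = PowerSeries.map (algebraMap ℂ A) C * P :=
    (map_algebraMap_commute C P).eq.symm
  have hcP : P * c = c * P := (hcom P).eq.symm
  have hLP : L * P = c * Ut * P := by
    have e1 : P * (P * PowerSeries.C x * P) = P * PowerSeries.C x * P := by
      simp only [← mul_assoc, hPP]
    have e2 : P * PowerSeries.C x * P * P = P * PowerSeries.C x * P := by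
      rw [mul_assoc _ P P, hPP]
    rw [hUt', hL, hU, sub_mul, mul_assoc PowerSeries.X, e2, mul_sub, hmP, ← mul_assoc P, hXP]
    simp only [sub_mul, add_mul, mul_assoc, hPP, one_mul]
    abel
  have hcomm : P * Ut = Ut * P := by
    have e1 : P * (P * PowerSeries.C x * P) = P * PowerSeries.C x * P := by
      simp only [← mul_assoc, hPP]
    have e2 : P * PowerSeries.C x * P * P = P * PowerSeries.C x * P := by
      rw [mul_assoc _ P P, hPP]
    have : P * (c * Ut) = (c * Ut) * P := by
      rw [hUt', mul_sub, mul_add, mul_sub, mul_one, hmP, hcP, ← mul_assoc P, hXP, mul_assoc _ P, e1,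
        sub_mul, mul_assoc PowerSeries.X _ P, e2, add_mul, sub_mul, one_mul]
    calc P * Ut = c' * (P * (c * Ut)) := by
          rw [← mul_assoc P, hcP, mul_assoc, ← mul_assoc, hcc, one_mul]
      _ = Ut * P := by rw [this, mul_assoc, ← mul_assoc, hcc, one_mul]
  have hRU : Rt * Ut = 1 := seriesResolvent_mul hC T
  have hUR : Ut * Rt = 1 := mul_seriesResolvent hC T
  have hPR : P * Rt = Rt * P := by
    calc P * Rt = Rt * Ut * P * Rt := by rw [hRU, one_mul]
      _ = Rt * (P * Ut) * Rt := by rw [hcomm]; simp only [mul_assoc]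
      _ = Rt * P * (Ut * Rt) := by simp only [mul_assoc]
      _ = Rt * P := by rw [hUR, mul_one]
  -- `L` agrees with `α (C_t - X T)` on the range of `p`, so the compressed inverses agree up to the
  -- factor `α`.
  have hmain : P * Rt * P = P * (1 + a) * V * P := by
    have e1 : P * Rt = (1 + a) * V * P := by
      have : L * (P * Rt) = c * P := by
        rw [← mul_assoc, hLP, mul_assoc, hPR, mul_assoc c, ← mul_assoc Ut, hUR, one_mul]
      calc P * Rt = (1 + a) * V * c' * L * (P * Rt) := by rw [hinv, one_mul]
        _ = (1 + a) * V * ((c' * c) * P) := by rw [mul_assoc _ L, this]; simp only [mul_assoc]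
        _ = (1 + a) * V * P := by rw [hcc, one_mul]
    calc P * Rt * P = P * (P * Rt) := by rw [mul_assoc, ← hPR]
      _ = P * (1 + a) * V * P := by rw [e1]; simp only [mul_assoc]
  intro n
  -- Writing `p = p° + α` on both sides leaves only alternating words in `p°` and `a`.
  have h01 : (0 : Fin 2) ≠ 1 := by decide
  have halt : ∀ k, φ (PowerSeries.coeff n (P * a * (q * a) ^ k * P)) = 0 := by
    intro k
    have e1 : P = q + c := by rw [hq, sub_add_cancel]
    have e2 : P * a * (q * a) ^ k * P = (q * a) ^ (k + 1) * q + c * ((q * a) ^ (k + 1)) +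
        c * ((a * q) ^ (k + 1)) + c * (c * ((a * q) ^ k * a)) := by
      have e3 : a * (q * a) ^ k = (a * q) ^ k * a := mul_mul_pow_comm q a k
      have e4 : P * a * (q * a) ^ k * P = P * (a * (q * a) ^ k) * P := by simp only [mul_assoc]
      have e5 : (q * a) ^ (k + 1) = q * (a * (q * a) ^ k) := by rw [pow_succ', mul_assoc]
      have e6 : (a * q) ^ (k + 1) = (a * (q * a) ^ k) * q := by rw [e3, pow_succ, mul_assoc]
      rw [e4, e5, e6, ← e3, e1, mul_add, ← (hcom _).eq, add_mul q c]
      simp only [mul_add, add_mul, mul_assoc]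
      abel
    have hcφ : ∀ f : A⟦X⟧, φ (PowerSeries.coeff n f) = 0 → φ (PowerSeries.coeff n (c * f)) = 0 := by
      intro f hf
      rw [hc, PowerSeries.coeff_C_mul, ← Algebra.smul_def, map_smul, hf, smul_zero]
    rw [e2, map_add, map_add, map_add, map_add, map_add, map_add,
      (((hqZ.mul haZ).pow (k + 1)).mul hqZ).map_eq_zero (hS.pow_mul_le_ker h01.symm (k + 1)),
      hcφ _ (((hqZ.mul haZ).pow (k + 1)).map_eq_zero (hS.pow_succ_le_ker h01.symm k) n),
      hcφ _ (((haZ.mul hqZ).pow (k + 1)).map_eq_zero (hS.pow_succ_le_ker h01 k) n),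
      hcφ _ (hcφ _ ((((haZ.mul hqZ).pow k).mul haZ).map_eq_zero (hS.pow_mul_le_ker h01 k) n))]
    simp
  have hwpow : ∀ k, w ^ k = PowerSeries.C (algebraMap ℂ A (α⁻¹ ^ k)) * (q * a) ^ k := by
    intro k
    rw [hw, (hcom' _).mul_pow, hc', ← map_pow, ← map_pow]
  have hscal : ∀ (β : ℂ) (f g : A⟦X⟧), φ (PowerSeries.coeff n
      (f * (PowerSeries.C (algebraMap ℂ A β) * g))) = β * φ (PowerSeries.coeff n (f * g)) := by
    intro β f g
    have : Commute (PowerSeries.C (algebraMap ℂ A β)) f := by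
      rw [← PowerSeries.map_C]; exact map_algebraMap_commute _ f
    rw [← mul_assoc, ← this.eq, mul_assoc, PowerSeries.coeff_C_mul, ← Algebra.smul_def, map_smul,
      smul_eq_mul]
  have hzero : φ (PowerSeries.coeff n (P * (1 + a) * w ^ 0 * P)) = if n = 0 then α else 0 := by
    have := halt 0
    rw [pow_zero, mul_one] at this
    rw [pow_zero, mul_one, mul_add, mul_one, add_mul, map_add, map_add, this, hPP, hP,
      PowerSeries.coeff_C, add_zero]
    split_ifs
    · exact hφp
    · simp
  -- The leading factor of `w ^ (k + 1)` is absorbed by `p p° = (1 - α) p`.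
  have hsucc : ∀ k, φ (PowerSeries.coeff n (P * (1 + a) * w ^ (k + 1) * P)) = 0 := by
    intro k
    have e1 : P * q = (1 - c) * P := by rw [hq, mul_sub, hPP, hcP, sub_mul, one_mul]
    have e2 : P * (1 + a) * (q * a) ^ (k + 1) * P =
        PowerSeries.C (algebraMap ℂ A (1 - α)) * (P * a * (q * a) ^ k * P) +
        P * a * (q * a) ^ (k + 1) * P := by
      have e3 : P * (q * a) ^ (k + 1) = (1 - c) * (P * a * (q * a) ^ k) := by
        rw [pow_succ', ← mul_assoc, ← mul_assoc, e1]; simp only [mul_assoc]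
      rw [mul_add, mul_one, add_mul, add_mul, e3, map_sub, map_sub, map_one, map_one,
        mul_assoc (1 - c)]
    rw [hwpow, mul_assoc _ _ P, mul_assoc (PowerSeries.C (algebraMap ℂ A _)), hscal, ← mul_assoc,
      e2, map_add, map_add,
      PowerSeries.coeff_C_mul, ← Algebra.smul_def, map_smul, halt, halt]
    simp
  have hcoeff : p * PowerSeries.coeff n Rt * p = PowerSeries.coeff n (P * Rt * P) := by
    rw [hP, PowerSeries.coeff_mul_C, PowerSeries.coeff_C_mul]
  rw [hψ, hcoeff, hmain, coeff_mul_mul_of_one_sub_mul hw0 hV, map_sum, Finset.sum_range_succ',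
    Finset.sum_eq_zero fun k _ => hsucc k, hzero, zero_add]
  split_ifs
  · exact inv_mul_cancel₀ hα
  · exact mul_zero _

end Compression

/-! ### Vector states -/

section VectorState

variable {H : Type*} [NormedAddCommGroup H] [InnerProductSpace ℂ H]

/-- The vector functional `T ↦ ⟪v, T v⟫`. -/
noncomputable def vectorState (v : H) : (H →L[ℂ] H) →ₗ[ℂ] ℂ where
  toFun T := ⟪v, T v⟫_ℂ
  map_add' S T := by simp
  map_smul' c T := by simp

theorem vectorState_apply (v : H) (T : H →L[ℂ] H) : vectorState v T = ⟪v, T v⟫_ℂ := rfl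

theorem isState_vectorState [CompleteSpace H] {v : H} (hv : ‖v‖ = 1) :
    IsState (vectorState v) := by
  refine ⟨?_, fun T => ?_⟩
  · rw [vectorState_apply, one_apply_eq_self, inner_self_eq_norm_sq_to_K, hv]
    simp
  · rw [vectorState_apply, mul_apply_eq_comp, ContinuousLinearMap.star_eq_adjoint,
      ContinuousLinearMap.adjoint_inner_right, inner_self_eq_norm_sq_to_K]
    norm_cast
    exact Complex.zero_le_real.2 (sq_nonneg _)

end VectorState

/-! ### Amplification to a Hilbert sum -/

section Amplification

variable {K T : Type*} [NormedAddCommGroup K] [InnerProductSpace ℂ K] [CompleteSpace K]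

/-- The diagonal action of the bounded operators of `K` on a Hilbert sum of copies of `K`. -/
noncomputable def amplification (K T : Type*) [NormedAddCommGroup K] [InnerProductSpace ℂ K]
    [CompleteSpace K] :
    (K →L[ℂ] K) →⋆ₐ[ℂ] (lp (fun _ : T => K) 2 →L[ℂ] lp (fun _ : T => K) 2) where
  toFun a := lp.mapCLM 2 (fun _ => a) (norm_nonneg a) (fun _ => le_rfl)
  map_one' := by ext f t; simp
  map_mul' a b := by ext f t; simp
  map_zero' := by ext f t; simp
  map_add' a b := by ext f t; simp
  commutes' r := by
    ext f t
    simp [Algebra.algebraMap_eq_smul_one]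
  map_star' a := by
    rw [ContinuousLinearMap.star_eq_adjoint, ContinuousLinearMap.star_eq_adjoint,
      ContinuousLinearMap.eq_adjoint_iff]
    intro f g
    rw [lp.inner_eq_tsum, lp.inner_eq_tsum]
    simp [ContinuousLinearMap.adjoint_inner_left]

/-- Conjugation by a unitary. -/
noncomputable def conjStarAlgHom {H H' : Type*} [NormedAddCommGroup H] [InnerProductSpace ℂ H]
    [CompleteSpace H] [NormedAddCommGroup H'] [InnerProductSpace ℂ H'] [CompleteSpace H']
    (e : H ≃ₗᵢ[ℂ] H') : (H →L[ℂ] H) →⋆ₐ[ℂ] (H' →L[ℂ] H') :=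
  StarAlgHomClass.toStarAlgHom e.conjStarAlgEquiv

theorem amplification_apply (a : K →L[ℂ] K) (f : lp (fun _ : T => K) 2) (t : T) :
    amplification K T a f t = a (f t) := by
  simp [amplification]

end Amplification

/-! ### The free product of Hilbert spaces -/

section FreeProduct

variable {ι : Type} {β : ι → Type} {o : ∀ i, β i}

/-- The index set of the canonical orthonormal basis of the free product of Hilbert spaces with
orthonormal bases indexed by `β i`, where `o i` is the index of the distinguished unit vector: words
in the letters of the sets `β i \ {o i}` in which neighbouring letters have different indices. -/
def FreeWord (o : ∀ i, β i) : Type :=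
  {l : List (Σ i, β i) // l.IsChain (fun a b => a.1 ≠ b.1) ∧ ∀ s ∈ l, s.2 ≠ o s.1}

/-- The empty word. -/
def FreeWord.nil (o : ∀ i, β i) : FreeWord o := ⟨[], by simp⟩

/-- The first letter of `w` has index `i`. -/
def FreeWord.StartsWith (i : ι) (w : FreeWord o) : Prop := ∃ s ∈ w.1.head?, s.1 = i

/-- The words whose first letter does not have index `i`. -/
def FreeWord.Tail (o : ∀ i, β i) (i : ι) : Type := {w : FreeWord o // ¬ w.StartsWith i}

open scoped Classical in
/-- Prepend the letter `n` of index `i`, or nothing if `n` is the distinguished letter. -/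
noncomputable def FreeWord.cons (i : ι) (x : β i × FreeWord.Tail o i) : FreeWord o :=
  if h : x.1 = o i then x.2.1 else
    ⟨⟨i, x.1⟩ :: x.2.1.1, by
      refine ⟨List.isChain_cons.2 ⟨fun s hs hi => x.2.2 ⟨s, hs, hi.symm⟩, x.2.1.2.1⟩, ?_⟩
      intro s hs
      rcases List.mem_cons.1 hs with rfl | hs
      · exact h
      · exact x.2.1.2.2 s hs⟩

theorem FreeWord.cons_o (i : ι) (τ : FreeWord.Tail o i) : FreeWord.cons i (o i, τ) = τ.1 := by
  simp [FreeWord.cons]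

theorem FreeWord.val_cons_of_ne {i : ι} {n : β i} (hn : n ≠ o i) (τ : FreeWord.Tail o i) :
    (FreeWord.cons i (n, τ)).1 = ⟨i, n⟩ :: τ.1.1 := by
  simp [FreeWord.cons, hn]

theorem FreeWord.startsWith_cons {i : ι} {n : β i} (hn : n ≠ o i) (τ : FreeWord.Tail o i) :
    (FreeWord.cons i (n, τ)).StartsWith i := by
  refine ⟨⟨i, n⟩, ?_, rfl⟩
  simp [FreeWord.val_cons_of_ne hn]

/-- Every word is uniquely a letter of index `i`, which is distinguished unless the word starts with
`i`, followed by a word not starting with `i`. -/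
theorem FreeWord.cons_bijective (i : ι) : Function.Bijective (FreeWord.cons (o := o) i) := by
  constructor
  · rintro ⟨n, τ⟩ ⟨n', τ'⟩ h
    by_cases hn : n = o i <;> by_cases hn' : n' = o i
    · subst hn hn'
      rw [FreeWord.cons_o, FreeWord.cons_o] at h
      rw [Subtype.ext h]
    · subst hn
      rw [FreeWord.cons_o] at h
      exact absurd (h ▸ FreeWord.startsWith_cons hn' τ') τ.2
    · subst hn'
      rw [FreeWord.cons_o] at h
      exact absurd (h ▸ FreeWord.startsWith_cons hn τ) τ'.2
    · have h' := congrArg Subtype.val h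
      simp only [FreeWord.val_cons_of_ne hn, FreeWord.val_cons_of_ne hn', List.cons.injEq,
        Sigma.mk.injEq, heq_eq_eq, true_and] at h'
      rw [h'.1, Subtype.ext (Subtype.ext h'.2)]
  · intro w
    by_cases hw : w.StartsWith i
    · obtain ⟨l, hc, ho⟩ := w
      obtain ⟨s, hs, rfl⟩ := hw
      cases l with
      | nil => simp at hs
      | cons s' l =>
        obtain rfl : s' = s := by simpa using hs
        have hc' := List.isChain_cons.1 hc
        refine ⟨(s'.2, ⟨⟨l, hc'.2, fun r hr => ho r (List.mem_cons_of_mem _ hr)⟩, ?_⟩), ?_⟩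
        · rintro ⟨r, hr, h⟩
          exact hc'.1 r hr h.symm
        · have : s'.2 ≠ o s'.1 := ho s' List.mem_cons_self
          exact Subtype.ext (FreeWord.val_cons_of_ne this _)
    · exact ⟨(o i, ⟨w, hw⟩), FreeWord.cons_o i _⟩

/-- The bijection `FreeWord.cons i`, as an equivalence. -/
noncomputable def FreeWord.consEquiv (o : ∀ i, β i) (i : ι) :
    β i × FreeWord.Tail o i ≃ FreeWord o :=
  Equiv.ofBijective _ (FreeWord.cons_bijective i)

variable {K : ι → Type} [∀ i, NormedAddCommGroup (K i)] [∀ i, InnerProductSpace ℂ (K i)]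

open scoped Classical in
/-- The orthonormal basis of `K i ⊗ ℓ²(Tail i)`, realized as a Hilbert sum of copies of `K i`,
indexed by words. -/
noncomputable def wordVector (o : ∀ i, β i) (b : ∀ i, HilbertBasis (β i) ℂ (K i)) (i : ι)
    (w : FreeWord o) : lp (fun _ : FreeWord.Tail o i => K i) 2 :=
  lp.single 2 ((FreeWord.consEquiv o i).symm w).2 (b i ((FreeWord.consEquiv o i).symm w).1)

open scoped Classical in
theorem inner_wordVector (b : ∀ i, HilbertBasis (β i) ℂ (K i)) (i : ι) (n : β i)
    (τ : FreeWord.Tail o i) (f : lp (fun _ : FreeWord.Tail o i => K i) 2) :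
    ⟪wordVector o b i (FreeWord.cons i (n, τ)), f⟫_ℂ = ⟪b i n, f τ⟫_ℂ := by
  have : (FreeWord.consEquiv o i).symm (FreeWord.cons i (n, τ)) = (n, τ) :=
    (FreeWord.consEquiv o i).symm_apply_apply _
  rw [wordVector, this, lp.inner_single_left]

theorem orthonormal_wordVector (o : ∀ i, β i) (b : ∀ i, HilbertBasis (β i) ℂ (K i)) (i : ι) :
    Orthonormal ℂ (wordVector o b i) := by
  classical
  rw [orthonormal_iff_ite]
  intro w w'
  obtain ⟨⟨n, τ⟩, rfl⟩ := (FreeWord.consEquiv o i).surjective w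
  obtain ⟨⟨n', τ'⟩, rfl⟩ := (FreeWord.consEquiv o i).surjective w'
  have h := inner_wordVector b i n τ (wordVector o b i (FreeWord.consEquiv o i (n', τ')))
  rw [show FreeWord.cons i (n, τ) = FreeWord.consEquiv o i (n, τ) from rfl] at h
  rw [h, wordVector, Equiv.symm_apply_apply]
  simp only [EmbeddingLike.apply_eq_iff_eq, Prod.mk.injEq]
  by_cases hτ : τ = τ'
  · subst hτ
    rw [lp.single_apply_self, orthonormal_iff_ite.1 (b i).orthonormal]
    simp
  · rw [lp.single_apply_ne _ _ _ hτ]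
    simp [hτ]

theorem wordVector_orthogonal_eq_bot (o : ∀ i, β i) (b : ∀ i, HilbertBasis (β i) ℂ (K i)) (i : ι) :
    (Submodule.span ℂ (Set.range (wordVector o b i)))ᗮ = ⊥ := by
  rw [Submodule.eq_bot_iff]
  intro f hf
  have h : ∀ n τ, ⟪b i n, f τ⟫_ℂ = 0 := fun n τ => by
    rw [← inner_wordVector]
    exact (Submodule.mem_orthogonal _ _).1 hf _ (Submodule.subset_span ⟨_, rfl⟩)
  ext τ
  have : (b i).repr (f τ) = 0 := by
    ext n
    rw [(b i).repr_apply_apply, h]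
    rfl
  simpa using this

variable [∀ i, CompleteSpace (K i)]

/-- The free product Hilbert space, with its canonical orthonormal basis of words. -/
abbrev FreeProductSpace (o : ∀ i, β i) : Type := lp (fun _ : FreeWord o => ℂ) 2

/-- The identification of `K i ⊗ ℓ²(Tail i)` with the free product Hilbert space. -/
noncomputable def freeProductEquiv (o : ∀ i, β i) (b : ∀ i, HilbertBasis (β i) ℂ (K i)) (i : ι) :
    lp (fun _ : FreeWord.Tail o i => K i) 2 ≃ₗᵢ[ℂ] FreeProductSpace o :=
  (HilbertBasis.mkOfOrthogonalEqBot (orthonormal_wordVector o b i)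
    (wordVector_orthogonal_eq_bot o b i)).repr

theorem freeProductEquiv_apply_cons (b : ∀ i, HilbertBasis (β i) ℂ (K i)) (i : ι)
    (f : lp (fun _ : FreeWord.Tail o i => K i) 2) (n : β i) (τ : FreeWord.Tail o i) :
    freeProductEquiv o b i f (FreeWord.cons i (n, τ)) = ⟪b i n, f τ⟫_ℂ := by
  rw [freeProductEquiv, HilbertBasis.repr_apply_apply, HilbertBasis.coe_mkOfOrthogonalEqBot,
    inner_wordVector]

/-- The action of the bounded operators of `K i` on the free product Hilbert space. -/
noncomputable def freeRep (o : ∀ i, β i) (b : ∀ i, HilbertBasis (β i) ℂ (K i)) (i : ι) :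
    (K i →L[ℂ] K i) →⋆ₐ[ℂ] (FreeProductSpace o →L[ℂ] FreeProductSpace o) :=
  (conjStarAlgHom (freeProductEquiv o b i)).comp
    (amplification (K i) (FreeWord.Tail o i))

open scoped Classical in
/-- The vacuum vector of the free product Hilbert space. -/
noncomputable def vacuum (o : ∀ i, β i) : FreeProductSpace o := lp.single 2 (FreeWord.nil o) 1

theorem inner_vacuum (h : FreeProductSpace o) : ⟪vacuum o, h⟫_ℂ = h (FreeWord.nil o) := by
  classical
  rw [vacuum, lp.inner_single_left]; simp

theorem norm_vacuum (o : ∀ i, β i) : ‖vacuum o‖ = 1 := by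
  classical
  rw [vacuum, lp.norm_single (by norm_num)]; simp

theorem vacuum_apply_of_startsWith {i : ι} {w : FreeWord o} (hw : w.StartsWith i) :
    vacuum o w = 0 := by
  classical
  refine lp.single_apply_ne _ _ _ ?_
  rintro rfl
  obtain ⟨s, hs, -⟩ := hw
  simp [FreeWord.nil] at hs

/-- A vector without components along words starting with `i` corresponds to a vector of
`e i ⊗ ℓ²(Tail i)`, so the component of its image under `a` along `e i ⊗ ℓ²(Tail i)` is a
multiple of the vector by the expectation of `a`. -/
theorem freeRep_apply_tail (b : ∀ i, HilbertBasis (β i) ℂ (K i)) (i : ι) (a : K i →L[ℂ] K i)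
    {h : FreeProductSpace o} (hh : ∀ w : FreeWord o, w.StartsWith i → h w = 0)
    (τ : FreeWord.Tail o i) :
    freeRep o b i a h τ.1 = h τ.1 * vectorState (b i (o i)) a := by
  set f := (freeProductEquiv o b i).symm h with hf
  have hfh : freeProductEquiv o b i f = h := by rw [hf, LinearIsometryEquiv.apply_symm_apply]
  have hfτ : f τ = h τ.1 • b i (o i) := by
    apply (b i).repr.injective
    ext n
    rw [(b i).repr_apply_apply, (b i).repr_apply_apply, ← freeProductEquiv_apply_cons, hfh,
      inner_smul_right]
    by_cases hn : n = o i
    · rw [hn, FreeWord.cons_o, inner_self_eq_norm_sq_to_K, (b i).orthonormal.1]; simp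
    · rw [hh _ (FreeWord.startsWith_cons hn τ), (b i).orthonormal.2 hn, mul_zero]
  have h1 : freeRep o b i a h = freeProductEquiv o b i (amplification (K i) _ a f) := rfl
  rw [h1, ← FreeWord.cons_o, freeProductEquiv_apply_cons, amplification_apply, hfτ, map_smul,
    inner_smul_right, FreeWord.cons_o, vectorState_apply]

theorem vectorState_vacuum_freeRep (b : ∀ i, HilbertBasis (β i) ℂ (K i)) (i : ι)
    (a : K i →L[ℂ] K i) :
    vectorState (vacuum o) (freeRep o b i a) = vectorState (b i (o i)) a := by
  have hnil : ¬ (FreeWord.nil o).StartsWith i := by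
    rintro ⟨s, hs, -⟩
    simp [FreeWord.nil] at hs
  rw [vectorState_apply, inner_vacuum]
  have := freeRep_apply_tail b i a (h := vacuum o) (fun w hw => vacuum_apply_of_startsWith hw)
    ⟨_, hnil⟩
  refine this.trans ?_
  classical
  have h1 : vacuum o (FreeWord.nil o) = 1 := by rw [vacuum, lp.single_apply_self]
  rw [h1, one_mul]

/-- Applying alternating centred operators to the vacuum produces vectors supported on the words
that start with the index of the last operator applied, so these are orthogonal to the vacuum. -/
theorem freeSubalgebras_freeRep (b : ∀ i, HilbertBasis (β i) ℂ (K i))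
    (S : ι → Subalgebra ℂ (FreeProductSpace o →L[ℂ] FreeProductSpace o))
    (hS : ∀ i, S i ≤ (freeRep o b i).toAlgHom.range) :
    FreeSubalgebras (vectorState (vacuum o)) S := by
  have key : ∀ (k : ℕ) (i : Fin (k + 1) → ι)
      (a : Fin (k + 1) → FreeProductSpace o →L[ℂ] FreeProductSpace o),
      (∀ j, a j ∈ S (i j)) → (∀ j : Fin k, i j.castSucc ≠ i j.succ) →
      (∀ j, vectorState (vacuum o) (a j) = 0) →
      ∀ w : FreeWord o, ¬ w.StartsWith (i 0) → (List.ofFn a).prod (vacuum o) w = 0 := by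
    intro k
    induction k with
    | zero =>
      intro i a ha hi h0 w hw
      obtain ⟨a', ha'⟩ := hS _ (ha 0)
      have h0' := h0 0
      have : (List.ofFn a).prod = freeRep o b (i 0) a' := by simpa using ha'.symm
      rw [this]
      rw [← ha'] at h0'
      refine (freeRep_apply_tail b (i 0) a' (fun w hw => vacuum_apply_of_startsWith hw)
        ⟨w, hw⟩).trans ?_
      rw [← vectorState_vacuum_freeRep]
      exact (congrArg _ h0').trans (mul_zero _)
    | succ k ih =>
      intro i a ha hi h0 w hw
      obtain ⟨a', ha'⟩ := hS _ (ha 0)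
      have h0' := h0 0
      rw [← ha'] at h0'
      have ih' := ih (fun j => i j.succ) (fun j => a j.succ) (fun j => ha _)
        (fun j => hi j.succ) (fun j => h0 _)
      rw [List.ofFn_succ, List.prod_cons, ← ha']
      refine (freeRep_apply_tail b (i 0) a' (fun w hw => ih' w ?_) ⟨w, hw⟩).trans ?_
      · rintro ⟨s, hs, h1⟩
        obtain ⟨s', hs', h2⟩ := hw
        rw [Option.mem_def] at hs hs'
        rw [hs] at hs'
        obtain rfl := Option.some_injective _ hs'
        exact hi 0 (h2.symm.trans h1)
      · rw [← vectorState_vacuum_freeRep]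
        exact (congrArg _ h0').trans (mul_zero _)
  intro k i a ha hi h0
  rw [vectorState_apply, inner_vacuum]
  refine key k i a ha hi h0 _ ?_
  rintro ⟨s, hs, -⟩
  simp [FreeWord.nil] at hs

end FreeProduct

/-! ### Moments of compactly supported measures -/

section Moments

theorem IsCompactlySupportedProb.exists_bound {μ : Measure ℝ} (hμ : IsCompactlySupportedProb μ) :
    ∃ M : ℝ, 0 < M ∧ ∀ᵐ x ∂μ, |x| ≤ M := by
  obtain ⟨h1, M, hM, h⟩ := hμ
  refine ⟨M, hM, ?_⟩
  filter_upwards [(mem_ae_iff_prob_eq_one measurableSet_Icc).2 h] with x hx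
  exact abs_le.2 hx

theorem integrable_of_ae_abs_le {μ : Measure ℝ} [IsFiniteMeasure μ] {M : ℝ}
    (hM : ∀ᵐ x ∂μ, |x| ≤ M) {f : ℝ → ℝ} (hf : Continuous f) : Integrable f μ := by
  obtain ⟨B, hB⟩ := (isCompact_Icc (a := -M) (b := M)).exists_bound_of_continuousOn hf.continuousOn
  refine Integrable.of_bound hf.aestronglyMeasurable B ?_
  filter_upwards [hM] with x hx
  exact hB x (abs_le.1 hx)

theorem integral_polynomial_eq {μ : Measure ℝ} [IsFiniteMeasure μ] {M : ℝ}
    (hM : ∀ᵐ x ∂μ, |x| ≤ M) (p : Polynomial ℝ) :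
    ∫ x, p.eval x ∂μ = ∑ i ∈ Finset.range (p.natDegree + 1), p.coeff i * moment μ i := by
  simp only [Polynomial.eval_eq_sum_range]
  rw [integral_finsetSum _ fun i _ => (integrable_of_ae_abs_le hM (continuous_pow i)).const_mul _]
  simp only [integral_const_mul, moment]

/-- A compactly supported probability measure is determined by its moments, by Weierstrass
approximation. -/
theorem eq_of_moment_eq {μ ν : Measure ℝ} (hμ : IsCompactlySupportedProb μ)
    (hν : IsCompactlySupportedProb ν) (h : ∀ n, moment μ n = moment ν n) : μ = ν := by
  obtain ⟨M₁, -, h₁⟩ := hμ.exists_bound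
  obtain ⟨M₂, -, h₂⟩ := hν.exists_bound
  have := hμ.1
  have := hν.1
  set M := max M₁ M₂
  have hM₁ : ∀ᵐ x ∂μ, |x| ≤ M := h₁.mono fun x hx => hx.trans (le_max_left _ _)
  have hM₂ : ∀ᵐ x ∂ν, |x| ≤ M := h₂.mono fun x hx => hx.trans (le_max_right _ _)
  refine ext_of_forall_integral_eq_of_IsFiniteMeasure fun f => ?_
  refine eq_of_forall_dist_le fun ε hε => ?_
  obtain ⟨p, hp⟩ := exists_polynomial_near_of_continuousOn (-M) M f f.continuous.continuousOn
    (ε / 2) (half_pos hε)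
  have key : ∀ (ρ : Measure ℝ), IsProbabilityMeasure ρ → (∀ᵐ x ∂ρ, |x| ≤ M) →
      |∫ x, p.eval x ∂ρ - ∫ x, f x ∂ρ| ≤ ε / 2 := by
    intro ρ _ hρ
    rw [← integral_sub (integrable_of_ae_abs_le hρ p.continuous)
      (integrable_of_ae_abs_le hρ f.continuous)]
    have := norm_integral_le_of_norm_le_const (μ := ρ) (C := ε / 2)
      (f := fun x => p.eval x - f x) (hρ.mono fun x hx => (hp x (abs_le.1 hx)).le)
    simpa using this
  have e : ∫ x, p.eval x ∂μ = ∫ x, p.eval x ∂ν := by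
    rw [integral_polynomial_eq hM₁, integral_polynomial_eq hM₂]
    simp only [h]
  have k₁ := key μ inferInstance hM₁
  have k₂ := key ν inferInstance hM₂
  rw [← e] at k₂
  rw [Real.dist_eq]
  rw [abs_le] at k₁ k₂ ⊢
  constructor <;> linarith [k₁.1, k₁.2, k₂.1, k₂.2]

end Moments

/-! ### Distributions of self-adjoint operators -/

section SpectralMeasure

variable {H : Type*} [NormedAddCommGroup H] [InnerProductSpace ℂ H] [CompleteSpace H]

/-- The functional `f ↦ re ⟪v, f(T) v⟫` on the real functions on the spectrum of `T`; it is positive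
since `f(T) = √f(T) ^ 2` for nonnegative `f`. -/
noncomputable def spectralFunctional {T : H →L[ℂ] H} (hT : IsSelfAdjoint T) (v : H) :
    CompactlySupportedContinuousMap (spectrum ℝ T) ℝ →ₚ[ℝ] ℝ :=
  PositiveLinearMap.mk₀
    { toFun := fun f => (vectorState v (cfcHom hT f.toContinuousMap)).re
      map_add' := fun f g => by
        have : (f + g).toContinuousMap = f.toContinuousMap + g.toContinuousMap := rfl
        rw [this, map_add, map_add, Complex.add_re]
      map_smul' := fun c f => by
        have : (c • f).toContinuousMap = c • f.toContinuousMap := rfl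
        rw [this, map_smul, vectorState_apply, vectorState_apply]
        have h2 : (c • cfcHom hT f.toContinuousMap) v =
            (c : ℂ) • cfcHom hT f.toContinuousMap v := by simp
        rw [h2, inner_smul_right, RingHom.id_apply, smul_eq_mul, Complex.re_ofReal_mul] }
    (fun f hf => by
      let g : C(spectrum ℝ T, ℝ) := ⟨fun x => Real.sqrt (f x), f.continuous.sqrt⟩
      have hg : f.toContinuousMap = star g * g := by
        ext x
        exact (Real.mul_self_sqrt (hf x)).symm
      change 0 ≤ (vectorState v (cfcHom hT f.toContinuousMap)).re
      rw [hg, map_mul, map_star, vectorState_apply, mul_apply_eq_comp,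
        ContinuousLinearMap.star_eq_adjoint, ContinuousLinearMap.adjoint_inner_right]
      exact inner_self_nonneg (𝕜 := ℂ) (x := cfcHom hT g v))

theorem spectralFunctional_apply {T : H →L[ℂ] H} (hT : IsSelfAdjoint T) (v : H)
    (f : CompactlySupportedContinuousMap (spectrum ℝ T) ℝ) :
    spectralFunctional hT v f = (vectorState v (cfcHom hT f.toContinuousMap)).re := rfl

theorem vectorState_im_eq_zero {T : H →L[ℂ] H} (hT : IsSelfAdjoint T) (v : H) :
    (vectorState v T).im = 0 := by
  rw [vectorState_apply, ← Complex.conj_eq_iff_im, inner_conj_symm]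
  conv_lhs => rw [← hT.star_eq, ContinuousLinearMap.star_eq_adjoint,
    ContinuousLinearMap.adjoint_inner_left]

/-- The distribution of a bounded self-adjoint operator in a vector state. -/
theorem exists_measure_moment_eq_vectorState {T : H →L[ℂ] H} (hT : IsSelfAdjoint T) {v : H}
    (hv : ‖v‖ = 1) :
    ∃ μ : Measure ℝ, IsCompactlySupportedProb μ ∧
      ∀ n : ℕ, vectorState v (T ^ n) = (moment μ n : ℂ) := by
  set ρ := RealRMK.rieszMeasure (spectralFunctional hT v) with hρ
  have hint : ∀ n : ℕ, ∫ x : spectrum ℝ T, (x : ℝ) ^ n ∂ρ = (vectorState v (T ^ n)).re := by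
    intro n
    let f : CompactlySupportedContinuousMap (spectrum ℝ T) ℝ :=
      CompactlySupportedContinuousMap.continuousMapEquiv
        ((ContinuousMap.restrict (spectrum ℝ T) (ContinuousMap.id ℝ)) ^ n)
    have h1 := RealRMK.integral_rieszMeasure (spectralFunctional hT v) f
    have h2 : cfcHom hT f.toContinuousMap = T ^ n := by
      conv_rhs => rw [← cfcHom_id (R := ℝ) hT]
      rw [← map_pow]
      rfl
    rw [spectralFunctional_apply, h2] at h1
    exact h1
  have hprob : IsProbabilityMeasure ρ := by
    have h0 := hint 0
    have : (vectorState v (T ^ 0)).re = 1 := by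
      rw [pow_zero, (isState_vectorState hv).1, Complex.one_re]
    rw [this] at h0
    simp only [pow_zero, integral_const, smul_eq_mul, mul_one] at h0
    exact ⟨by simpa [Measure.real, ENNReal.toReal_eq_one_iff] using h0⟩
  refine ⟨ρ.map Subtype.val, ⟨?_, ‖T‖ + 1, by positivity, ?_⟩, fun n => ?_⟩
  · exact Measure.isProbabilityMeasure_map measurable_subtype_coe.aemeasurable
  · rw [Measure.map_apply measurable_subtype_coe measurableSet_Icc]
    convert hprob.measure_univ
    refine Set.eq_univ_of_forall fun x => ?_
    have : Nontrivial H := ⟨v, 0, fun h => by simp [h] at hv⟩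
    have h1 : |(x : ℝ)| ≤ ‖T‖ := spectrum.norm_le_norm_of_mem x.2
    rw [Set.mem_preimage, Set.mem_Icc, ← abs_le]
    linarith
  · rw [moment, integral_map measurable_subtype_coe.aemeasurable
      (continuous_pow n).aestronglyMeasurable, hint n]
    exact Complex.ext rfl (by rw [vectorState_im_eq_zero (hT.pow n), Complex.ofReal_im])

end SpectralMeasure

/-! ### The multiplication operator on `L²(μ)` -/

section Multiplication

variable {μ : Measure ℝ}

/-- Multiplication by the coordinate `s`, which is essentially bounded for `μ`. -/
theorem exists_mulOperator (hμ : IsCompactlySupportedProb μ) :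
    ∃ x : Lp ℂ 2 μ →L[ℂ] Lp ℂ 2 μ, ∀ f, x f =ᵐ[μ] fun s => (s : ℂ) * f s := by
  obtain ⟨M, hM0, hM⟩ := hμ.exists_bound
  have hmem : MemLp (fun s : ℝ => (s : ℂ)) ∞ μ :=
    memLp_top_of_bound Complex.continuous_ofReal.aestronglyMeasurable M
      (hM.mono fun s hs => by simpa using hs)
  have hco : ∀ f : Lp ℂ 2 μ, ((hmem.toLp _ • f : Lp ℂ 2 μ) : ℝ → ℂ) =ᵐ[μ]
      fun s => (s : ℂ) * f s := fun f => by
    filter_upwards [Lp.coeFn_lpSMul (r := 2) (hmem.toLp _) f, hmem.coeFn_toLp] with s h1 h2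
    rw [h1, Pi.smul_apply', h2, smul_eq_mul]
  refine ⟨LinearMap.mkContinuous
    { toFun := fun f => (hmem.toLp _ • f : Lp ℂ 2 μ)
      map_add' := fun f g => Lp.add_smul _ _ _
      map_smul' := fun c f => by
        apply Lp.ext
        filter_upwards [hco (c • f), Lp.coeFn_smul c f, hco f,
          Lp.coeFn_smul c (hmem.toLp _ • f : Lp ℂ 2 μ)] with s h1 h2 h3 h4
        rw [h1, h2, RingHom.id_apply, h4, Pi.smul_apply, Pi.smul_apply, h3]
        simp only [smul_eq_mul]; ring }
    ‖hmem.toLp _‖ fun f => Lp.norm_smul_le _ _, fun f => hco f⟩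

variable {x : Lp ℂ 2 μ →L[ℂ] Lp ℂ 2 μ}

theorem isSelfAdjoint_mulOperator (hx : ∀ f, x f =ᵐ[μ] fun s => (s : ℂ) * f s) :
    IsSelfAdjoint x := by
  rw [ContinuousLinearMap.isSelfAdjoint_iff_isSymmetric]
  intro f g
  change ⟪x f, g⟫_ℂ = ⟪f, x g⟫_ℂ
  rw [L2.inner_def, L2.inner_def]
  refine integral_congr_ae ?_
  filter_upwards [hx f, hx g] with s h1 h2
  rw [h1, h2]
  simp only [RCLike.inner_apply, map_mul, Complex.conj_ofReal]
  ring

theorem mulOperator_idempotent (hx : ∀ f, x f =ᵐ[μ] fun s => (s : ℂ) * f s)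
    (h : ∀ᵐ s ∂μ, s * s = s) : x * x = x := by
  ext1 f
  apply Lp.ext
  filter_upwards [hx f, hx (x f), h] with s h1 h2 h3
  rw [mul_apply_eq_comp, h2, h1, ← mul_assoc, ← Complex.ofReal_mul, h3]

theorem mulOperator_pow_apply (hx : ∀ f, x f =ᵐ[μ] fun s => (s : ℂ) * f s)
    (n : ℕ) (f : Lp ℂ 2 μ) :
    (x ^ n) f =ᵐ[μ] fun s => (s : ℂ) ^ n * f s := by
  induction n with
  | zero => simp
  | succ n ih =>
    filter_upwards [ih, hx ((x ^ n) f)] with s h1 h2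
    rw [pow_succ', mul_apply_eq_comp, h2, h1]
    ring

theorem vectorState_mulOperator [IsProbabilityMeasure μ]
    (hx : ∀ f, x f =ᵐ[μ] fun s => (s : ℂ) * f s) (n : ℕ) :
    vectorState (Lp.const 2 μ (1 : ℂ)) (x ^ n) = (moment μ n : ℂ) := by
  rw [vectorState_apply, L2.inner_def, moment, ← integral_complex_ofReal]
  refine integral_congr_ae ?_
  filter_upwards [mulOperator_pow_apply hx n (Lp.const 2 μ (1 : ℂ)),
    Lp.coeFn_const (p := 2) (μ := μ) (1 : ℂ)] with s h1 h2
  rw [h1, h2]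
  simp

theorem norm_const_one [IsProbabilityMeasure μ] : ‖Lp.const 2 μ (1 : ℂ)‖ = 1 := by
  rw [Lp.norm_const' 2 μ (1 : ℂ) two_ne_zero ENNReal.ofNat_ne_top]
  simp

end Multiplication

/-! ### Free copies of prescribed distributions -/

section FreePair

theorem exists_hilbertBasis_of_norm_eq_one {K : Type} [NormedAddCommGroup K]
    [InnerProductSpace ℂ K] [CompleteSpace K] {e : K} (he : ‖e‖ = 1) :
    ∃ (β : Type) (o : β) (b : HilbertBasis β ℂ K), b o = e := by
  have h : Orthonormal ℂ ((↑) : ({e} : Set K) → K) := by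
    refine ⟨fun x => by rw [x.2, he], fun x y hxy => absurd (Subsingleton.elim x y) hxy⟩
  obtain ⟨w, b, hw, hb⟩ := h.exists_hilbertBasis_extension
  exact ⟨w, ⟨e, hw rfl⟩, b, by rw [hb]⟩

/-- Any two compactly supported probability measures are the distributions of free bounded
self-adjoint operators, in a vector state on a Hilbert space. The second operator can be taken to be
a projection if the second measure is carried by `{0, 1}`. -/
theorem exists_free_operators {μ ν : Measure ℝ} (hμ : IsCompactlySupportedProb μ)
    (hν : IsCompactlySupportedProb ν) :
    ∃ (H : Type) (_ : NormedAddCommGroup H) (_ : InnerProductSpace ℂ H) (_ : CompleteSpace H)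
      (Ω : H) (x y : H →L[ℂ] H), ‖Ω‖ = 1 ∧ IsSelfAdjoint x ∧ IsSelfAdjoint y ∧
      FreeVariables (vectorState Ω) ![x, y] ∧
      (∀ n : ℕ, vectorState Ω (x ^ n) = (moment μ n : ℂ)) ∧
      (∀ n : ℕ, vectorState Ω (y ^ n) = (moment ν n : ℂ)) ∧
      ((∀ᵐ s ∂ν, s * s = s) → y * y = y) := by
  let ρ : Fin 2 → Measure ℝ := ![μ, ν]
  have hρ : ∀ i, IsCompactlySupportedProb (ρ i) := by
    intro i
    fin_cases i
    · exact hμ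
    · exact hν
  have hρ' : ∀ i, IsProbabilityMeasure (ρ i) := fun i => (hρ i).1
  choose x hx using fun i => exists_mulOperator (hρ i)
  have he : ∀ i, ‖Lp.const 2 (ρ i) (1 : ℂ)‖ = 1 := fun i => norm_const_one
  choose β o b hb using fun i => exists_hilbertBasis_of_norm_eq_one (he i)
  have hmom : ∀ i (n : ℕ), vectorState (vacuum o) (freeRep o b i (x i) ^ n) =
      (moment (ρ i) n : ℂ) := fun i n => by
    rw [← map_pow, vectorState_vacuum_freeRep, hb, vectorState_mulOperator (hx i)]
  refine ⟨FreeProductSpace o, inferInstance, inferInstance, inferInstance, vacuum o,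
    freeRep o b 0 (x 0), freeRep o b 1 (x 1), norm_vacuum o,
    (isSelfAdjoint_mulOperator (hx 0)).map _, (isSelfAdjoint_mulOperator (hx 1)).map _, ?_,
    hmom 0, hmom 1, fun h => ?_⟩
  · refine freeSubalgebras_freeRep b _ fun i => ?_
    refine Algebra.adjoin_le (Set.singleton_subset_iff.2 ?_)
    fin_cases i
    · exact ⟨x 0, rfl⟩
    · exact ⟨x 1, rfl⟩
  · rw [← map_mul, mulOperator_idempotent (hx 1) h]

end FreePair

/-! ### Consequences for cumulant series of measures -/

section Measures

theorem isCompactlySupportedProb_bernoulli {α : ℝ} (h0 : 0 ≤ α) (h1 : α ≤ 1) :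
    IsCompactlySupportedProb
      (ENNReal.ofReal (1 - α) • Measure.dirac (0 : ℝ) + ENNReal.ofReal α • Measure.dirac 1) := by
  have h : ENNReal.ofReal (1 - α) + ENNReal.ofReal α = 1 := by
    rw [← ENNReal.ofReal_add (by linarith) h0]; simp
  exact ⟨⟨by simpa using h⟩, 1, one_pos, by simpa using h⟩

/-- The measures `μ_t`: the distribution of `t p x p` in the compression by `p`, where `x` has
distribution `μ` and `p` is a projection of trace `1 / t` that is free from `x`. -/
theorem exists_measure_hasCumulantSeries {μ : Measure ℝ} (hμ : IsCompactlySupportedProb μ)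
    {C : ℂ⟦X⟧} (hC : HasCumulantSeries (fun n => (moment μ n : ℂ)) C) {t : ℝ} (ht : 1 ≤ t) :
    ∃ ν : Measure ℝ, IsCompactlySupportedProb ν ∧
      HasCumulantSeries (fun n => (moment ν n : ℂ)) (1 + (t : ℂ) • (C - 1)) := by
  have ht0 : 0 < t := by linarith
  have hν := isCompactlySupportedProb_bernoulli (inv_nonneg.2 ht0.le) (inv_le_one_of_one_le₀ ht)
  obtain ⟨H, _, _, _, Ω, x, p, hΩ, hxs, hps, hfree, hxm, hpm, hpp⟩ := exists_free_operators hμ hν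
  -- The Bernoulli distribution is carried by `{0, 1}`.
  have hpp' : p * p = p := hpp (by
    rw [ae_add_measure_iff]
    refine ⟨Measure.ae_smul_measure ?_ _, Measure.ae_smul_measure ?_ _⟩ <;>
      rw [ae_dirac_iff (measurableSet_eq_fun (by fun_prop) (by fun_prop))] <;> simp)
  have hφp : vectorState Ω p = ((t⁻¹ : ℝ) : ℂ) := by
    have h1 := hpm 1
    rw [pow_one] at h1
    rw [h1, moment]
    congr 1
    have hi : ∀ a c : ℝ, Integrable (fun s : ℝ => s ^ 1) (ENNReal.ofReal a • Measure.dirac c) :=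
      fun a c => (integrable_dirac (by simp)).smul_measure ENNReal.ofReal_ne_top
    rw [integral_add_measure (hi _ _) (hi _ _), integral_smul_measure, integral_smul_measure,
      integral_dirac, integral_dirac, ENNReal.toReal_ofReal (inv_nonneg.2 ht0.le)]
    simp
  have hα : ((t⁻¹ : ℝ) : ℂ) ≠ 0 := by exact_mod_cast (inv_ne_zero ht0.ne')
  have hinv : (((t⁻¹ : ℝ) : ℂ))⁻¹ = (t : ℂ) := by push_cast; rw [inv_inv]
  have hcomp := HasCumulantSeries.compression (isState_vectorState hΩ).1 hfree
    (x := x) (p := p) (Algebra.subset_adjoin rfl) (Algebra.subset_adjoin rfl) hpp' hα hφp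
    (by simpa only [hxm] using hC)
  rw [hinv] at hcomp
  set T : H →L[ℂ] H := (t : ℂ) • (p * x * p) with hT
  have hTs : IsSelfAdjoint T := by
    have h1 : IsSelfAdjoint (p * x * p) := by
      have := hxs.conjugate p
      rwa [hps.star_eq] at this
    exact IsSelfAdjoint.smul (Complex.conj_ofReal t) h1
  have hpadj : ∀ u w : H, ⟪p u, w⟫_ℂ = ⟪u, p w⟫_ℂ := fun u w => by
    conv_rhs => rw [← hps.star_eq, ContinuousLinearMap.star_eq_adjoint,
      ContinuousLinearMap.adjoint_inner_right]
  -- The compressed state `b ↦ t φ(p b p)` is the vector state of `√t p Ω`.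
  have hstate : ∀ b : H →L[ℂ] H, vectorState ((Real.sqrt t : ℂ) • p Ω) b =
      t * vectorState Ω (p * b * p) := by
    intro b
    have hs : ((Real.sqrt t : ℝ) : ℂ) * (Real.sqrt t : ℝ) = t := by
      rw [← Complex.ofReal_mul, Real.mul_self_sqrt ht0.le]
    rw [vectorState_apply, vectorState_apply, map_smul, inner_smul_left, inner_smul_right,
      Complex.conj_ofReal, ← mul_assoc, hs, hpadj]
    rfl
  have hv : ‖(Real.sqrt t : ℂ) • p Ω‖ = 1 := by
    have h1 : vectorState ((Real.sqrt t : ℂ) • p Ω) 1 = 1 := by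
      rw [hstate, mul_one, hpp', hφp, ← Complex.ofReal_mul, mul_inv_cancel₀ ht0.ne',
        Complex.ofReal_one]
    rw [vectorState_apply, one_apply_eq_self, inner_self_eq_norm_sq_to_K] at h1
    have h2 : ((‖(Real.sqrt t : ℂ) • p Ω‖ ^ 2 : ℝ) : ℂ) = 1 := by
      rw [← h1, Complex.ofReal_pow]; rfl
    exact (pow_eq_one_iff_of_nonneg (norm_nonneg _) two_ne_zero).1 (by exact_mod_cast h2)
  obtain ⟨ν, hν, hνm⟩ := exists_measure_moment_eq_vectorState hTs hv
  refine ⟨ν, hν, ?_⟩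
  simpa only [← hνm, hstate] using hcomp

/-- The cumulant series of a free convolution. -/
theorem IsFreeConvolution.hasCumulantSeries {μ ν ρ : Measure ℝ} (h : IsFreeConvolution μ ν ρ)
    {C C' : ℂ⟦X⟧} (hC : HasCumulantSeries (fun n => (moment μ n : ℂ)) C)
    (hC' : HasCumulantSeries (fun n => (moment ν n : ℂ)) C') :
    HasCumulantSeries (fun n => (moment ρ n : ℂ)) (C + C' - 1) := by
  obtain ⟨A, _, _, _, _, φ, x, y, hφ, -, -, hfree, hx, hy, hxy⟩ := h
  simp only [← hx.2] at hC
  simp only [← hy.2] at hC'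
  simp only [← hxy.2]
  exact HasCumulantSeries.add hφ.1 hfree (Algebra.subset_adjoin rfl) (Algebra.subset_adjoin rfl)
    hC hC'

/-- A measure with the cumulant series `C + C' - 1` is the free convolution of measures with the
cumulant series `C` and `C'`. -/
theorem eq_freeConvolution_of_hasCumulantSeries {μ ν ρ : Measure ℝ}
    (hμ : IsCompactlySupportedProb μ) (hν : IsCompactlySupportedProb ν)
    (hρ : IsCompactlySupportedProb ρ) {C C' : ℂ⟦X⟧}
    (hC : HasCumulantSeries (fun n => (moment μ n : ℂ)) C)
    (hC' : HasCumulantSeries (fun n => (moment ν n : ℂ)) C')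
    (h : HasCumulantSeries (fun n => (moment ρ n : ℂ)) (C + C' - 1)) :
    ρ = freeConvolution μ ν := by
  obtain ⟨H, _, _, _, Ω, x, y, hΩ, hxs, hys, hfree, hxm, hym, -⟩ := exists_free_operators hμ hν
  have hadd := HasCumulantSeries.add (isState_vectorState hΩ).1 hfree
    (x := x) (y := y) (Algebra.subset_adjoin rfl) (Algebra.subset_adjoin rfl)
    (by simpa only [hxm] using hC) (by simpa only [hym] using hC')
  have hex : ∃ ρ, IsFreeConvolution μ ν ρ :=
    ⟨ρ, H →L[ℂ] H, inferInstance, inferInstance, inferInstance, inferInstance, vectorState Ω, x, y,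
      isState_vectorState hΩ, hxs, hys, hfree, ⟨hμ, hxm⟩, ⟨hν, hym⟩, hρ,
      congrFun (hadd.moments_unique h)⟩
  rw [freeConvolution, dif_pos hex]
  have hspec := hex.choose_spec
  have hc : IsCompactlySupportedProb hex.choose := by
    obtain ⟨A, _, _, _, _, φ, x, y, -, -, -, -, -, -, hxy⟩ := hspec
    exact hxy.1
  refine eq_of_moment_eq hρ hc fun n => ?_
  exact_mod_cast congrFun (h.moments_unique (hspec.hasCumulantSeries hC hC')) n

end Measures

/-! ### Taylor series -/

section Taylor

/-- The power series `a` is the Taylor series of `f` at `0`: modulo `z ^ N`, both agree with the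
same polynomial. -/
def HasTaylorSeries (f : ℂ → ℂ) (a : ℂ⟦X⟧) : Prop :=
  ∀ N : ℕ, ∃ (p : ℂ[X]) (g : ℂ → ℂ), AnalyticAt ℂ g 0 ∧
    PowerSeries.X ^ N ∣ a - (p : ℂ⟦X⟧) ∧ ∀ᶠ z in 𝓝 (0 : ℂ), f z = p.eval z + z ^ N * g z

variable {f g : ℂ → ℂ} {a b : ℂ⟦X⟧}

/-- A polynomial that is divisible by `z ^ N` as a germ of analytic functions at `0` is divisible by
`X ^ N`. -/
theorem X_pow_dvd_of_eventually_eq {p : ℂ[X]} {N : ℕ} (hg : AnalyticAt ℂ g 0)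
    (h : ∀ᶠ z in 𝓝 (0 : ℂ), p.eval z = z ^ N * g z) : (Polynomial.X : ℂ[X]) ^ N ∣ p := by
  induction N generalizing g with
  | zero => simp
  | succ N ih =>
    obtain ⟨q, rfl⟩ := ih (analyticAt_id.mul hg) (h.mono fun z hz => by
      rw [hz, pow_succ, mul_assoc]; rfl)
    have h1 : ∀ᶠ z in 𝓝[≠] (0 : ℂ), q.eval z = z * g z := by
      filter_upwards [h.filter_mono nhdsWithin_le_nhds, self_mem_nhdsWithin] with z hz hz0
      refine mul_left_cancel₀ (pow_ne_zero N hz0) ?_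
      simpa [pow_succ, mul_assoc] using hz
    have h2 : q.eval 0 = 0 * g 0 := by
      refine tendsto_nhds_unique_of_eventuallyEq (l := 𝓝[≠] (0 : ℂ))
        (q.continuous.tendsto 0 |>.mono_left nhdsWithin_le_nhds)
        ((continuousAt_id.mul hg.continuousAt).tendsto.mono_left nhdsWithin_le_nhds) h1
    rw [zero_mul] at h2
    obtain ⟨r, rfl⟩ : (Polynomial.X : ℂ[X]) ∣ q := by
      rw [Polynomial.X_dvd_iff, Polynomial.coeff_zero_eq_eval_zero, h2]
    exact ⟨r, by ring⟩

theorem coe_X_pow_dvd {p : ℂ[X]} {N : ℕ} (h : (Polynomial.X : ℂ[X]) ^ N ∣ p) :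
    (PowerSeries.X : ℂ⟦X⟧) ^ N ∣ (p : ℂ⟦X⟧) := by
  obtain ⟨q, rfl⟩ := h
  exact ⟨q, by push_cast; rfl⟩

theorem eq_of_forall_X_pow_dvd_sub (h : ∀ N : ℕ, (PowerSeries.X : ℂ⟦X⟧) ^ N ∣ a - b) : a = b := by
  ext n
  have := PowerSeries.X_pow_dvd_iff.1 (h (n + 1)) n n.lt_succ_self
  simpa [sub_eq_zero] using this

theorem HasTaylorSeries.unique (hf : HasTaylorSeries f a) (hf' : HasTaylorSeries f b) : a = b := by
  refine eq_of_forall_X_pow_dvd_sub fun N => ?_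
  obtain ⟨p, g, hg, hp, h⟩ := hf N
  obtain ⟨p', g', hg', hp', h'⟩ := hf' N
  have h1 : (Polynomial.X : ℂ[X]) ^ N ∣ p - p' := by
    refine X_pow_dvd_of_eventually_eq (hg'.sub hg) ?_
    filter_upwards [h, h'] with z hz hz'
    rw [Polynomial.eval_sub, Pi.sub_apply]
    linear_combination hz' - hz
  have h2 := dvd_add (dvd_sub hp hp') (coe_X_pow_dvd h1)
  convert h2 using 1
  push_cast
  ring

theorem HasTaylorSeries.congr (hf : HasTaylorSeries f a) (h : f =ᶠ[𝓝 0] g) :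
    HasTaylorSeries g a := by
  intro N
  obtain ⟨p, g', hg, hp, h'⟩ := hf N
  refine ⟨p, g', hg, hp, ?_⟩
  filter_upwards [h, h'] with z hz hz'
  rw [← hz, hz']

theorem HasTaylorSeries.polynomial (p : ℂ[X]) : HasTaylorSeries (fun z => p.eval z) (p : ℂ⟦X⟧) :=
  fun N => ⟨p, 0, analyticAt_const, by simp, by simp⟩

theorem HasTaylorSeries.const (c : ℂ) : HasTaylorSeries (fun _ => c) (PowerSeries.C c) := by
  simpa using HasTaylorSeries.polynomial (Polynomial.C c)

theorem HasTaylorSeries.id : HasTaylorSeries (fun z => z) PowerSeries.X := by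
  simpa using HasTaylorSeries.polynomial (Polynomial.X)

theorem HasTaylorSeries.add (hf : HasTaylorSeries f a) (hg : HasTaylorSeries g b) :
    HasTaylorSeries (fun z => f z + g z) (a + b) := by
  intro N
  obtain ⟨p, f', hf', hp, h⟩ := hf N
  obtain ⟨q, g', hg', hq, h'⟩ := hg N
  refine ⟨p + q, f' + g', hf'.add hg', ?_, ?_⟩
  · convert dvd_add hp hq using 1; push_cast; ring
  · filter_upwards [h, h'] with z hz hz'
    rw [hz, hz', Polynomial.eval_add, Pi.add_apply]; ring

theorem HasTaylorSeries.mul (hf : HasTaylorSeries f a) (hg : HasTaylorSeries g b) :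
    HasTaylorSeries (fun z => f z * g z) (a * b) := by
  intro N
  obtain ⟨p, f', hf', hp, h⟩ := hf N
  obtain ⟨q, g', hg', hq, h'⟩ := hg N
  have hpoly : ∀ r : ℂ[X], AnalyticAt ℂ (fun z => r.eval z) 0 := fun r =>
    (AnalyticAt.aeval_polynomial analyticAt_id r).congr (by simp [Polynomial.aeval_def,
      Polynomial.eval₂_eq_eval_map])
  refine ⟨p * q, fun z => p.eval z * g' z + q.eval z * f' z + z ^ N * (f' z * g' z), ?_, ?_, ?_⟩
  · exact (((hpoly p).mul hg').add ((hpoly q).mul hf')).add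
      ((analyticAt_id.pow N).mul (hf'.mul hg'))
  · convert dvd_add (hp.mul_right b) (hq.mul_left (p : ℂ⟦X⟧)) using 1; push_cast; ring
  · filter_upwards [h, h'] with z hz hz'
    rw [hz, hz', Polynomial.eval_mul]; ring

theorem HasTaylorSeries.pow (hf : HasTaylorSeries f a) (k : ℕ) :
    HasTaylorSeries (fun z => f z ^ k) (a ^ k) := by
  induction k with
  | zero => simpa using HasTaylorSeries.const 1
  | succ k ih => simpa only [pow_succ] using ih.mul hf

theorem HasTaylorSeries.sum {ι : Type*} (s : Finset ι) {f : ι → ℂ → ℂ} {a : ι → ℂ⟦X⟧}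
    (hf : ∀ i ∈ s, HasTaylorSeries (f i) (a i)) :
    HasTaylorSeries (fun z => ∑ i ∈ s, f i z) (∑ i ∈ s, a i) := by
  classical
  induction s using Finset.induction_on with
  | empty => simpa using HasTaylorSeries.const 0
  | insert i s hi ih =>
    simp only [Finset.sum_insert hi]
    exact (hf i (Finset.mem_insert_self i s)).add
      (ih fun j hj => hf j (Finset.mem_insert_of_mem hj))

theorem exists_hasTaylorSeries (hf : AnalyticAt ℂ f 0) : ∃ a, HasTaylorSeries f a := by
  refine ⟨PowerSeries.mk fun n => iteratedDeriv n f 0 / n.factorial, fun N => ?_⟩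
  obtain ⟨F, hF, h⟩ := hf.exists_eventuallyEq_sum_add_pow_mul N
  refine ⟨PowerSeries.trunc N (PowerSeries.mk fun n => iteratedDeriv n f 0 / n.factorial), F, hF,
    ?_, ?_⟩
  · rw [PowerSeries.X_pow_dvd_iff]
    intro m hm
    rw [map_sub, Polynomial.coeff_coe, PowerSeries.coeff_trunc, if_pos hm, sub_self]
  · filter_upwards [h] with z hz
    rw [hz, ← Polynomial.eval₂_id, PowerSeries.eval₂_trunc_eq_sum_range]
    simp only [RingHom.id_apply, PowerSeries.coeff_mk, smul_eq_mul, add_left_inj]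
    exact Finset.sum_congr rfl fun i _ => by ring

theorem HasTaylorSeries.eventually_eq (hf : AnalyticAt ℂ f 0) (hg : AnalyticAt ℂ g 0)
    (hfa : HasTaylorSeries f a) (hga : HasTaylorSeries g a) : f =ᶠ[𝓝 0] g := by
  have h : ∀ N : ℕ, (N : ℕ∞) ≤ analyticOrderAt (f - g) 0 := by
    intro N
    obtain ⟨p, f', hf', hp, h⟩ := hfa N
    obtain ⟨q, g', hg', hq, h'⟩ := hga N
    have h1 : (Polynomial.X : ℂ[X]) ^ N ∣ p - q := by
      rw [Polynomial.X_pow_dvd_iff]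
      intro d hd
      have := PowerSeries.X_pow_dvd_iff.1 (dvd_sub hq hp) d hd
      simpa using this
    obtain ⟨r, hr⟩ := h1
    rw [natCast_le_analyticOrderAt (hf.sub hg)]
    refine ⟨fun z => r.eval z + (f' z - g' z), ?_, ?_⟩
    · exact ((AnalyticAt.aeval_polynomial analyticAt_id r).congr (by simp [Polynomial.aeval_def,
        Polynomial.eval₂_eq_eval_map])).add (hf'.sub hg')
    · filter_upwards [h, h'] with z hz hz'
      have := congrArg (Polynomial.eval z) hr
      rw [Polynomial.eval_sub, Polynomial.eval_mul, Polynomial.eval_pow, Polynomial.eval_X] at this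
      rw [Pi.sub_apply, hz, hz', sub_zero, smul_eq_mul]
      linear_combination this
  have htop : analyticOrderAt (f - g) 0 = ⊤ := ENat.eq_top_iff_forall_ge.2 h
  filter_upwards [analyticOrderAt_eq_top.1 htop] with z hz
  exact sub_eq_zero.1 hz

end Taylor

/-! ### The `R`-transform of a compactly supported measure -/

section RTransform

variable {μ : Measure ℝ}

/-- The generating function `u ↦ ∑ k, m_{n+k} u ^ k` of the moments from the `n`-th on. -/
noncomputable def momentTail (μ : Measure ℝ) (n : ℕ) (u : ℂ) : ℂ :=
  ∫ s : ℝ, (s : ℂ) ^ n / (1 - u * s) ∂μ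

/-- The integrands of `momentTail` are bounded, uniformly in `u` in a disc around `0`. -/
theorem exists_radius (hμ : IsCompactlySupportedProb μ) :
    ∃ r : ℝ, 0 < r ∧ ∃ M : ℝ, 0 < M ∧ ∀ᵐ s : ℝ ∂μ, |s| ≤ M ∧
      ∀ u : ℂ, ‖u‖ < r → 1 / 2 ≤ ‖1 - u * s‖ := by
  obtain ⟨M, hM0, hM⟩ := hμ.exists_bound
  refine ⟨1 / (2 * M), by positivity, M, hM0, hM.mono fun s hs => ⟨hs, fun u hu => ?_⟩⟩
  have h1 : ‖u * s‖ ≤ 1 / 2 := by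
    rw [norm_mul, Complex.norm_real, Real.norm_eq_abs]
    calc ‖u‖ * |s| ≤ 1 / (2 * M) * M := by gcongr
      _ = 1 / 2 := by field_simp
  have h2 := norm_sub_norm_le (1 : ℂ) (u * s)
  rw [norm_one] at h2
  linarith

theorem integrable_momentTail (hμ : IsCompactlySupportedProb μ) (n : ℕ) :
    ∀ᶠ u in 𝓝 (0 : ℂ), Integrable (fun s : ℝ => (s : ℂ) ^ n / (1 - u * s)) μ := by
  obtain ⟨r, hr, M, hM0, h⟩ := exists_radius hμ
  have := hμ.1
  filter_upwards [Metric.ball_mem_nhds (0 : ℂ) hr] with u hu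
  rw [mem_ball_zero_iff] at hu
  refine Integrable.of_bound (Measurable.aestronglyMeasurable (by fun_prop)) (M ^ n / (1 / 2)) ?_
  filter_upwards [h] with s hs
  rw [norm_div, norm_pow, Complex.norm_real, Real.norm_eq_abs]
  exact div_le_div₀ (by positivity) (pow_le_pow_left₀ (abs_nonneg s) hs.1 n) (by norm_num)
    (hs.2 u hu)

theorem analyticAt_momentTail (hμ : IsCompactlySupportedProb μ) (n : ℕ) :
    AnalyticAt ℂ (momentTail μ n) 0 := by
  obtain ⟨r, hr, M, hM0, h⟩ := exists_radius hμ
  have := hμ.1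
  rw [Complex.analyticAt_iff_eventually_differentiableAt]
  filter_upwards [Metric.ball_mem_nhds (0 : ℂ) hr, integrable_momentTail hμ n] with u hu hint
  refine (hasDerivAt_integral_of_dominated_loc_of_deriv_le (μ := μ)
    (F := fun (u : ℂ) (s : ℝ) => (s : ℂ) ^ n / (1 - u * s))
    (F' := fun (u : ℂ) (s : ℝ) => (s : ℂ) ^ (n + 1) / (1 - u * s) ^ 2)
    (bound := fun _ => M ^ (n + 1) / (1 / 2) ^ 2) (s := Metric.ball 0 r)
    (Metric.isOpen_ball.mem_nhds hu) ?_ ?_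
    (Measurable.aestronglyMeasurable (by fun_prop)) ?_ (integrable_const _) ?_).2.differentiableAt
  · exact Eventually.of_forall fun v => Measurable.aestronglyMeasurable (by fun_prop)
  · exact hint
  · filter_upwards [h] with s hs v hv
    rw [norm_div, norm_pow, norm_pow, Complex.norm_real, Real.norm_eq_abs]
    exact div_le_div₀ (by positivity) (pow_le_pow_left₀ (abs_nonneg s) hs.1 _) (by norm_num)
      (pow_le_pow_left₀ (by norm_num) (hs.2 v (mem_ball_zero_iff.1 hv)) 2)
  · filter_upwards [h] with s hs v hv
    have h0 : 1 - v * s ≠ 0 := by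
      intro h0
      have := hs.2 v (mem_ball_zero_iff.1 hv)
      rw [h0, norm_zero] at this
      norm_num at this
    have h1 : HasDerivAt (fun v : ℂ => 1 - v * s) (-s : ℂ) v := by
      simpa using ((hasDerivAt_id v).mul_const (s : ℂ)).const_sub 1
    refine ((hasDerivAt_const v ((s : ℂ) ^ n)).div h1 h0).congr_deriv ?_
    ring

theorem momentTail_zero_right (μ : Measure ℝ) (n : ℕ) : momentTail μ n 0 = (moment μ n : ℂ) := by
  simp only [momentTail, moment, zero_mul, sub_zero, div_one]
  rw [← integral_complex_ofReal]
  simp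

theorem momentTail_succ (hμ : IsCompactlySupportedProb μ) (n : ℕ) :
    ∀ᶠ u in 𝓝 (0 : ℂ), momentTail μ n u = (moment μ n : ℂ) + u * momentTail μ (n + 1) u := by
  have := hμ.1
  obtain ⟨r, hr, M, hM0, h⟩ := exists_radius hμ
  have h0 := (integrable_momentTail hμ n).self_of_nhds
  filter_upwards [integrable_momentTail hμ (n + 1), Metric.ball_mem_nhds (0 : ℂ) hr] with u hu hur
  simp only [zero_mul, sub_zero, div_one] at h0
  rw [← momentTail_zero_right]
  simp only [momentTail, zero_mul, sub_zero, div_one]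
  rw [← integral_const_mul, ← integral_add h0 (hu.const_mul u)]
  refine integral_congr_ae ?_
  filter_upwards [h] with s hs
  have h1 : 1 - u * s ≠ 0 := by
    intro h1
    have := hs.2 u (mem_ball_zero_iff.1 hur)
    rw [h1, norm_zero] at this
    norm_num at this
  field_simp
  ring

/-- Expansion of the moment generating function with remainder. -/
theorem momentTail_zero_eq (hμ : IsCompactlySupportedProb μ) (N : ℕ) :
    ∀ᶠ u in 𝓝 (0 : ℂ), momentTail μ 0 u =
      ∑ k ∈ Finset.range N, (moment μ k : ℂ) * u ^ k + u ^ N * momentTail μ N u := by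
  induction N with
  | zero => simp
  | succ N ih =>
    filter_upwards [ih, momentTail_succ hμ N] with u h1 h2
    rw [h1, h2, Finset.sum_range_succ]
    ring

/-- `G_μ(1 / u) = ∑ k, m_k u ^ (k + 1)`. -/
theorem cauchyTransform_inv {u : ℂ} (hu : u ≠ 0) :
    cauchyTransform μ (1 / u) = u * momentTail μ 0 u := by
  rw [cauchyTransform, momentTail, ← integral_const_mul]
  congr 1
  ext s
  rw [pow_zero, mul_one_div, one_div, show 1 / u - (s : ℂ) = (1 - u * s) / u by field_simp, inv_div]

/-- The `R`-transform exists: with a local inverse `ψ` of `u ↦ G_μ(1 / u)` at `0` one has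
`ψ(w) = w / c(w)` where `c` is analytic and `c(0) = 1`, and `R(w) = (c(w) - 1) / w`. -/
theorem exists_isRTransform (hμ : IsCompactlySupportedProb μ) : ∃ R, IsRTransform μ R := by
  have := hμ.1
  have h0 : momentTail μ 0 0 = 1 := by rw [momentTail_zero_right]; simp [moment]
  set g : ℂ → ℂ := fun u => u * momentTail μ 0 u with hg
  have hga : AnalyticAt ℂ g 0 := analyticAt_id.mul (analyticAt_momentTail hμ 0)
  have hg0 : g 0 = 0 := by simp [hg]
  have hderiv : HasDerivAt g 1 0 := by
    have := (hasDerivAt_id (0 : ℂ)).mul (analyticAt_momentTail hμ 0).differentiableAt.hasDerivAt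
    exact this.congr_deriv (by simp [h0])
  have hne : deriv g 0 ≠ 0 := by rw [hderiv.deriv]; exact one_ne_zero
  set ψ := hga.hasStrictDerivAt.localInverse _ _ _ hne with hψ
  have hψa : AnalyticAt ℂ ψ 0 := by
    have := hga.analyticAt_localInverse hne
    rwa [hg0] at this
  have hψ0 : ψ 0 = 0 := by
    have : ψ (g 0) = 0 := HasStrictFDerivAt.localInverse_apply_image ..
    rwa [hg0] at this
  have hright : ∀ᶠ w in 𝓝 (0 : ℂ), g (ψ w) = w := by
    have := hga.hasStrictDerivAt.eventually_right_inverse hne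
    rwa [hg0] at this
  have hca : AnalyticAt ℂ (fun w => momentTail μ 0 (ψ w)) 0 := by
    refine AnalyticAt.comp (g := momentTail μ 0) ?_ hψa
    rw [hψ0]; exact analyticAt_momentTail hμ 0
  obtain ⟨R, hR, hc⟩ := hca.exists_eventuallyEq_sum_add_pow_mul 1
  refine ⟨R, hR, ?_⟩
  filter_upwards [hc.filter_mono nhdsWithin_le_nhds, hright.filter_mono nhdsWithin_le_nhds,
    self_mem_nhdsWithin] with w hw hgw hw0
  have hw0 : w ≠ 0 := hw0
  have hψw : ψ w ≠ 0 := by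
    intro h
    rw [h, hg0] at hgw
    exact hw0 hgw.symm
  have hK : R w + 1 / w = 1 / ψ w := by
    have e1 : momentTail μ 0 (ψ w) = 1 + w * R w := by
      simpa [hψ0, h0] using hw
    have e2 : ψ w * (1 + w * R w) = w := by rw [← e1]; exact hgw
    field_simp
    linear_combination e2
  rw [hK, cauchyTransform_inv hψw]
  exact hgw

theorem isRTransform_rTransform (hμ : IsCompactlySupportedProb μ) :
    IsRTransform μ (rTransform μ) := by
  have h := exists_isRTransform hμ
  rw [rTransform, dif_pos h]
  exact h.choose_spec

/-- If `R` is the `R`-transform of `μ`, then `1 + z R(z)` has the cumulant series of `μ` as its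
Taylor series. -/
theorem IsRTransform.hasCumulantSeries (hμ : IsCompactlySupportedProb μ) {R : ℂ → ℂ}
    (hR : IsRTransform μ R) {r : ℂ⟦X⟧} (hr : HasTaylorSeries R r) :
    HasCumulantSeries (fun n => (moment μ n : ℂ)) (1 + PowerSeries.X * r) := by
  set C : ℂ⟦X⟧ := 1 + PowerSeries.X * r with hC
  have hC1 : PowerSeries.constantCoeff C = 1 := by simp [hC]
  have hca : AnalyticAt ℂ (fun w => 1 + w * R w) 0 :=
    analyticAt_const.add (analyticAt_id.mul hR.1)
  have hc0 : (1 : ℂ) + 0 * R 0 ≠ 0 := by simp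
  have hc : HasTaylorSeries (fun w => 1 + w * R w) C := by
    simpa using (HasTaylorSeries.const 1).add (HasTaylorSeries.id.mul hr)
  set d : ℂ → ℂ := fun w => (1 + w * R w)⁻¹ with hd
  have hda : AnalyticAt ℂ d 0 := hca.inv hc0
  have hcd : ∀ᶠ w in 𝓝 (0 : ℂ), (1 + w * R w) * d w = 1 := by
    filter_upwards [hca.continuousAt.eventually_ne hc0] with w hw
    exact mul_inv_cancel₀ hw
  have hdC : HasTaylorSeries d C⁻¹ := by
    obtain ⟨e, he⟩ := exists_hasTaylorSeries hda
    have h1 : C * e = 1 := (hc.mul he).unique (by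
      simpa using (HasTaylorSeries.const 1).congr (hcd.mono fun w hw => hw.symm))
    have h2 : e = C⁻¹ := by
      rw [PowerSeries.eq_inv_iff_mul_eq_one (by simp [hC1]), mul_comm, h1]
    rwa [← h2]
  set f : ℂ → ℂ := fun w => w * d w with hf
  have hfa : AnalyticAt ℂ f 0 := analyticAt_id.mul hda
  have hf0 : f 0 = 0 := by simp [hf]
  have hfC : HasTaylorSeries f (PowerSeries.X * C⁻¹) := HasTaylorSeries.id.mul hdC
  -- the defining equation of the `R`-transform in terms of the moment generating function
  have hgf : ∀ᶠ w in 𝓝 (0 : ℂ), f w * momentTail μ 0 (f w) = w := by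
    have h1 := eventually_nhdsWithin_iff.1 hR.2
    filter_upwards [h1, hcd] with w hw hcw
    by_cases hw0 : w = 0
    · rw [hw0, hf0, zero_mul]
    · have hdw : d w ≠ 0 := right_ne_zero_of_mul_eq_one hcw
      have hfw : f w ≠ 0 := mul_ne_zero hw0 hdw
      have hK : R w + 1 / w = 1 / f w := by
        simp only [hf]
        field_simp
        linear_combination hcw
      rw [← cauchyTransform_inv hfw, ← hK]
      exact hw hw0
  have hft : Tendsto f (𝓝 0) (𝓝 0) := by
    have := hfa.continuousAt.tendsto
    rwa [hf0] at this
  refine ⟨hC1, fun n => ?_⟩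
  -- compare Taylor coefficients up to order `n + 1`
  have hs : HasTaylorSeries (fun w => ∑ k ∈ Finset.range (n + 1), (moment μ k : ℂ) * f w ^ (k + 1))
      (∑ k ∈ Finset.range (n + 1),
        PowerSeries.C (moment μ k : ℂ) * (PowerSeries.X * C⁻¹) ^ (k + 1)) :=
    HasTaylorSeries.sum _ fun k _ => (HasTaylorSeries.const _).mul (hfC.pow _)
  obtain ⟨p, h, hh, hp, hph⟩ := hs (n + 2)
  have hta : AnalyticAt ℂ (fun w => d w ^ (n + 2) * momentTail μ (n + 1) (f w)) 0 := by
    refine (hda.pow _).mul (AnalyticAt.comp (g := momentTail μ (n + 1)) ?_ hfa)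
    rw [hf0]; exact analyticAt_momentTail hμ _
  have hdvd : (Polynomial.X : Polynomial ℂ) ^ (n + 2) ∣ Polynomial.X - p := by
    refine X_pow_dvd_of_eventually_eq (hh.add hta) ?_
    filter_upwards [hgf, hph, hft.eventually (momentTail_zero_eq hμ (n + 1))] with w h1 h2 h3
    rw [h3, mul_add, Finset.mul_sum] at h1
    have e1 : ∀ k ∈ Finset.range (n + 1), f w * ((moment μ k : ℂ) * f w ^ k) =
        (moment μ k : ℂ) * f w ^ (k + 1) := fun k _ => by ring
    rw [Finset.sum_congr rfl e1, h2] at h1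
    rw [Polynomial.eval_sub, Polynomial.eval_X, Pi.add_apply]
    have e2 : f w = w * d w := rfl
    rw [e2] at h1
    linear_combination -h1
  have hcoeff := PowerSeries.X_pow_dvd_iff.1 (dvd_sub (coe_X_pow_dvd hdvd) hp) (n + 1) (by omega)
  have e1 : ∀ k ∈ Finset.range (n + 1), PowerSeries.coeff (n + 1)
      (PowerSeries.C (moment μ k : ℂ) * (PowerSeries.X * C⁻¹) ^ (k + 1)) =
      (moment μ k : ℂ) * PowerSeries.coeff (n - k) (C⁻¹ ^ (k + 1)) := fun k hk => by
    have := Finset.mem_range.1 hk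
    rw [PowerSeries.coeff_C_mul, mul_pow, PowerSeries.coeff_X_pow_mul', if_pos (by omega),
      Nat.add_sub_add_right]
  rw [← Finset.sum_congr rfl e1, ← map_sum]
  rw [Polynomial.coe_sub, sub_sub_sub_cancel_right, map_sub, sub_eq_zero, Polynomial.coe_X,
    PowerSeries.coeff_X] at hcoeff
  rw [← hcoeff]
  simp

/-- Multiplying the cumulants by `t` multiplies the `R`-transform by `t` near `0`. -/
theorem IsRTransform.eventually_eq_smul {ν : Measure ℝ} (hμ : IsCompactlySupportedProb μ)
    (hν : IsCompactlySupportedProb ν) {R R' : ℂ → ℂ} (hR : IsRTransform μ R)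
    (hR' : IsRTransform ν R') {t : ℂ}
    (h : ∀ C, HasCumulantSeries (fun n => (moment μ n : ℂ)) C →
      HasCumulantSeries (fun n => (moment ν n : ℂ)) (1 + t • (C - 1))) :
    ∀ᶠ z in 𝓝 (0 : ℂ), R' z = t * R z := by
  obtain ⟨r, hr⟩ := exists_hasTaylorSeries hR.1
  obtain ⟨r', hr'⟩ := exists_hasTaylorSeries hR'.1
  have h1 := h _ (hR.hasCumulantSeries hμ hr)
  have h2 := h1.unique (hR'.hasCumulantSeries hν hr')
  have h3 : r' = PowerSeries.C t * r := by
    rw [add_sub_cancel_left, add_right_inj, PowerSeries.smul_eq_C_mul] at h2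
    refine mul_left_cancel₀ PowerSeries.X_ne_zero (h2.symm.trans ?_)
    ring
  rw [h3] at hr'
  exact hr'.eventually_eq hR'.1 (analyticAt_const.mul hR.1) ((HasTaylorSeries.const t).mul hr)

end RTransform

end FreeProb

open FreeProb
theorem mainTheorem6 (μ : Measure ℝ) (hμ : IsCompactlySupportedProb μ) :
    ∃ μt : ℝ → Measure ℝ,
      (∀ t : ℝ, 1 ≤ t → IsCompactlySupportedProb (μt t)) ∧
      IsRTransform μ (rTransform μ) ∧
      (∀ t : ℝ, 1 ≤ t → IsRTransform (μt t) (rTransform (μt t)) ∧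
        ∀ᶠ z in 𝓝 (0 : ℂ), rTransform (μt t) z = (t : ℂ) * rTransform μ z) ∧
      μt 1 = μ ∧
      (∀ s t : ℝ, 1 ≤ s → 1 ≤ t → μt (s + t) = freeConvolution (μt s) (μt t)) ∧
      (∀ n : ℕ, 1 ≤ n → ContinuousOn (fun t => moment (μt t) n) (Set.Ici 1)) ∧
      (∀ n : ℕ, 1 ≤ n → ContinuousOn (fun t => cumulant (μt t) n) (Set.Ici 1)) := by
  have hR := isRTransform_rTransform hμ
  obtain ⟨r, hr⟩ := exists_hasTaylorSeries hR.1
  have hC := hR.hasCumulantSeries hμ hr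
  generalize hCdef : (1 + PowerSeries.X * r : PowerSeries ℂ) = C at hC
  choose! μt hμt hCt using fun (t : ℝ) (ht : 1 ≤ t) => exists_measure_hasCumulantSeries hμ hC ht
  have hmom : ∀ n, ContinuousOn (fun t => moment (μt t) n) (Set.Ici 1) := by
    intro n
    have h := continuousOn_of_hasCumulantSeries (C := fun t : ℝ => 1 + (t : ℂ) • (C - 1))
      (m := fun t n => (moment (μt t) n : ℂ)) (s := Set.Ici 1) (fun t => ?_) (fun n => ?_) hCt n
    · exact (Complex.continuous_re.comp_continuousOn h).congr fun t _ => (Complex.ofReal_re _).symm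
    · rw [PowerSeries.smul_eq_C_mul]
      simp [hC.1]
    · simp only [map_add, PowerSeries.coeff_smul]
      fun_prop
  refine ⟨μt, hμt, hR, fun t ht => ⟨isRTransform_rTransform (hμt t ht), ?_⟩, ?_, ?_,
    fun n _ => hmom n, fun n _ => continuousOn_freeCumulant hmom n⟩
  · refine hR.eventually_eq_smul hμ (hμt t ht) (isRTransform_rTransform (hμt t ht)) fun C' hC' => ?_
    rw [hC'.unique hC]
    exact hCt t ht
  · have h1 := hCt 1 le_rfl
    rw [Complex.ofReal_one, one_smul, add_sub_cancel] at h1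
    refine eq_of_moment_eq (hμt 1 le_rfl) hμ fun n => ?_
    exact_mod_cast congrFun (h1.moments_unique hC) n
  · intro s t hs ht
    have hst : 1 ≤ s + t := by linarith
    refine eq_freeConvolution_of_hasCumulantSeries (hμt s hs) (hμt t ht) (hμt _ hst) (hCt s hs)
      (hCt t ht) ?_
    have h1 := hCt (s + t) hst
    convert h1 using 1
    rw [Complex.ofReal_add, add_smul]
    ring
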